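/- **Flow Combining Lemma.** *Conventions.* A *flow* on $\mathbb{R}^d$ is a family $v=\{v_t\}_{t\in[0,1]}$ of vector fields $v_t:\mathbb{R}^d\to\mathbb{R}^d$. Its trajectory from $x_1\in\mathbb{R}^d$ is the solution on $[0,1]$ of $\frac{dx_t}{dt}=-v_t(x_t)$ with value $x_1$ at time $t=1$, in the integrated (Carathéodory) sense: $s\mapsto v_s(x_s)$ is integrable on $[0,1]$ and $x_t=x_1+\int_t^1 v_s(x_s)\,ds$ for all $t\in[0,1]$. Say that the flow ODE of $v$ is *well posed at $x_1$* if exactly one such solution exists; then $\mathrm{RunFlow}(v,x_1,t)$ denotes its value at time $t$. For a probability measure $q$ such that the ODE is well posed at $q$-almost every $x_1$ and $x_1\mapsto\mathrm{RunFlow}(v,x_1,0)$ is $q$-measurable, let $v(q)$ be the law of $\mathrm{RunFlow}(v,x_1,0)$ for $x_1\sim q$; we say that $v$ *transports* $q$ to $p$ if moreover $v(q)=p$. *Random flows.* Let $(v,x_1)$ be a random flow together with a random initial point, defined on a probability space, and put $x_t:=\mathrm{RunFlow}(v,x_1,t)$ and $w_t:=v_t(x_t)$. Assume throughout that $v_t(x)$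 is jointly measurable in the random parameter, $t$ and $x$; that almost surely the ODE of $v$ is well posed at $x_1$; that each $x_t$ is a random variable; and that $\int_0^1\mathbb{E}\|w_t\|\,dt<\infty$. A *marginal flow* is a jointly measurable field $(t,x)\mapsto v^*_t(x)$ such that, for almost every $t\in[0,1]$, $$v^*_t(x_t)=\mathbb{E}[w_t\mid x_t]=\mathbb{E}[v_t(x_t)\mid x_t]\quad\text{almost surely.}$$ **(a)** Let $\Gamma$ be a distribution over pairs $(v,q_v)$ of a flow and an initial probability distribution on $\mathbb{R}^d$ (a probability space with a random flow $v$ and a Markov kernel $q_v$), and let $(v,q_v)\sim\Gamma$, $x_1\sim q_v$, under the assumptions above. Then a marginal flow $v^*$ exists, and every marginal flow $v^*$ whose ODE is well posed at $\mathbb{E}[q_v]$-almost every initial point transports the mixture $\mathbb{E}[q_v]$ to the mixture $\mathbb{E}[v(q_v)]$. **(b)** In particular, let $q,p$ be probability measures on $\mathbb{R}^d$, let $\Pi$ be a coupling of $q$ and $p$, and for points $x_1,x_0$ let $u^{x_1,x_0}$ be a flow such that, for $\Pi$-almost every $(x_1,x_0)$, it is a pointwise flow from $x_1$ to $x_0$,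 that is, its ODE is well posed at $x_1$ and $\mathrm{RunFlow}(u^{x_1,x_0},x_1,0)=x_0$. Let $(x_1,x_0)\sim\Pi$ and $v:=u^{x_1,x_0}$, under the assumptions above. Then a marginal flow $v^*$ exists, i.e. $v^*_t(x_t)=\mathbb{E}[u^{x_1,x_0}_t(x_t)\mid x_t]$ with $x_t=\mathrm{RunFlow}(u^{x_1,x_0},x_1,t)$, and every marginal flow $v^*$ whose ODE is well posed at $q$-almost every initial point transports $q$ to $p$. -/

import Mathlib

open MeasureTheory ProbabilityTheory Set

/-- A flow on `ℝᵈ`: a family of vector fields `v t : ℝᵈ → ℝᵈ` indexed by time.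
Only the times `t ∈ [0, 1]` matter. -/
abbrev FlowField (d : ℕ) : Type :=
  ℝ → EuclideanSpace ℝ (Fin d) → EuclideanSpace ℝ (Fin d)

/-- `γ` solves `dγ/dt = - v t (γ t)` on `[0, 1]` with initial condition `γ 1 = x₁` at time `1`,
in integrated form (Carathéodory solution):
`γ t = x₁ + ∫_t^1 v s (γ s) ds`, with `s ↦ v s (γ s)` integrable on `[0, 1]`. -/
def IsTrajectory {d : ℕ} (v : FlowField d) (x₁ : EuclideanSpace ℝ (Fin d))
    (γ : ℝ → EuclideanSpace ℝ (Fin d)) : Prop :=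
  IntervalIntegrable (fun s => v s (γ s)) volume 0 1 ∧
    ∀ t ∈ Icc (0 : ℝ) 1, γ t = x₁ + ∫ s in t..1, v s (γ s)

/-- The flow ODE has exactly one solution on `[0, 1]` starting from `x₁` at time `1`. -/
def WellPosedAt {d : ℕ} (v : FlowField d) (x₁ : EuclideanSpace ℝ (Fin d)) : Prop :=
  (∃ γ, IsTrajectory v x₁ γ) ∧
    ∀ γ γ', IsTrajectory v x₁ γ → IsTrajectory v x₁ γ' → EqOn γ γ' (Icc 0 1)

open Classical in
/-- `runFlow v x₁ t` is the value at time `t ∈ [0, 1]` of the solution of the flow ODE started from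
`x₁` at time `1`. It is meaningful where `WellPosedAt v x₁` holds. -/
noncomputable def runFlow {d : ℕ} (v : FlowField d) (x₁ : EuclideanSpace ℝ (Fin d)) (t : ℝ) :
    EuclideanSpace ℝ (Fin d) :=
  if h : ∃ γ, IsTrajectory v x₁ γ then h.choose t else x₁

/-- The final distribution `v(q)` obtained by transporting the initial distribution `q` along `v`
from time `1` to time `0`. -/
noncomputable def finalLaw {d : ℕ} (v : FlowField d) (q : Measure (EuclideanSpace ℝ (Fin d))) :
    Measure (EuclideanSpace ℝ (Fin d)) :=
  q.map (fun x₁ => runFlow v x₁ 0)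

/-- The flow `v` transports `q` to `p`: for `q`-almost every initial point the flow ODE has a unique
solution, its final point is a random variable under `q`, and the law of this variable is `p`. -/
def Transports {d : ℕ} (v : FlowField d) (q p : Measure (EuclideanSpace ℝ (Fin d))) : Prop :=
  (∀ᵐ x₁ ∂q, WellPosedAt v x₁) ∧ AEMeasurable (fun x₁ => runFlow v x₁ 0) q ∧ finalLaw v q = p

/-- A pointwise flow between `x₁` and `x₀`: its trajectory from `x₁` at time `1` ends
in `x₀` at time `0`. -/
def IsPointwiseFlow {d : ℕ} (v : FlowField d) (x₁ x₀ : EuclideanSpace ℝ (Fin d)) : Prop :=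
  WellPosedAt v x₁ ∧ runFlow v x₁ 0 = x₀

/-- The joint law, on `(ℝᵈ)³`, of `(x₁, x_t, w_t)`, where `x₁ = X s` and `v = V s` are random,
`x_t = runFlow v x₁ t` and `w_t = v t x_t`. -/
noncomputable def jointLaw {d : ℕ} {S : Type*} [MeasurableSpace S] (P : Measure S)
    (V : S → FlowField d) (X : S → EuclideanSpace ℝ (Fin d)) (t : ℝ) :
    Measure (EuclideanSpace ℝ (Fin d) × EuclideanSpace ℝ (Fin d) × EuclideanSpace ℝ (Fin d)) :=
  P.map (fun s => (X s, runFlow (V s) (X s) t, V s t (runFlow (V s) (X s) t)))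

/-- `vs` is a (jointly measurable version of the) marginal flow: for almost every time `t ∈ [0, 1]`,
`vs t x_t = 𝔼[w_t | x_t]` almost surely under the joint law of `(x₁, x_t, w_t)`. -/
def IsMarginalFlow {d : ℕ} {S : Type*} [MeasurableSpace S] (P : Measure S)
    (V : S → FlowField d) (X : S → EuclideanSpace ℝ (Fin d)) (vs : FlowField d) : Prop :=
  Measurable (fun z : ℝ × EuclideanSpace ℝ (Fin d) => vs z.1 z.2) ∧
    ∀ᵐ t ∂(volume.restrict (Icc (0 : ℝ) 1)),
      (fun z => vs t z.2.1) =ᵐ[jointLaw P V X t]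
        (jointLaw P V X t)[fun z => z.2.2 |
          MeasurableSpace.comap (fun z => z.2.1) inferInstance]

/-- Standing conventions on a random flow `V` with random initial point `X`: the velocity
`V s t x` is jointly measurable, the flow ODE almost surely has a unique solution, each position
`x_t` is a random variable, and `∫₀¹ 𝔼 ‖w_t‖ dt < ∞`. -/
structure IsRegularRandomFlow {d : ℕ} {S : Type*} [MeasurableSpace S] (P : Measure S)
    (V : S → FlowField d) (X : S → EuclideanSpace ℝ (Fin d)) : Prop where
  measurable_velocity :
    Measurable (fun z : S × ℝ × EuclideanSpace ℝ (Fin d) => V z.1 z.2.1 z.2.2)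
  wellPosed : ∀ᵐ s ∂P, WellPosedAt (V s) (X s)
  aemeasurable_position : ∀ t ∈ Icc (0 : ℝ) 1, AEMeasurable (fun s => runFlow (V s) (X s) t) P
  integrable_velocity :
    ∫⁻ t in Icc (0 : ℝ) 1, ∫⁻ z, ‖z.2.2‖ₑ ∂(jointLaw P V X t) < ⊤

/-!
Let `y` be the random trajectory in reversed time, `w` its velocity and `b` the marginal field, so
that `b r (y r) = 𝔼[w r | y r]`. Resample the process at the times of a fine grid: at each grid time
draw the next position from its conditional law given the present position only. The resulting
Markov chain has the same one-time laws as `y`, and its drift over a grid step is the average of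
`w` over that step given the present position, which is close to `b`. The velocity is merely
integrable, so the martingale part is estimated in `L²` only after truncating the increments at a
small level; the increments above this level disappear as the grid is refined. A generic shift of
the grid avoids the null set of times at which the conditional expectation is not given by `b`, and
makes the step approximations of `w` and of `b r (y r)` along the grid converge in mean. The laws of
the chains are tight at rational times, and a limit law is carried by solutions of the ODE of `b`
whose one-time laws are still those of `y`. Uniqueness of the solution from almost every starting
point then makes the final point a function of the starting point, and this function transports the
initial law to the final one.
-/

open Filter Topology

section Martingale

variable {Ω E : Type*} {m0 : MeasurableSpace Ω} {μ : Measure Ω} [NormedAddCommGroup E]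

lemma eLpNorm_two_sq_le_of_enorm_le {f : Ω → E} {R : NNReal} (hR : ∀ ω, ‖f ω‖ₑ ≤ R) :
    eLpNorm f 2 μ ^ 2 ≤ R * ∫⁻ ω, ‖f ω‖ₑ ∂μ := by
  have h := eLpNorm_nnreal_pow_eq_lintegral (μ := μ) (f := f) (p := 2) two_ne_zero
  simp only [NNReal.coe_ofNat, ENNReal.rpow_ofNat, ENNReal.coe_ofNat] at h
  rw [h, ← lintegral_const_mul' _ _ ENNReal.coe_ne_top]
  refine lintegral_mono fun ω => ?_
  rw [sq]
  gcongr
  exact hR ω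

lemma enorm_indicator_compl_le (f : Ω → E) (R : ENNReal) (ω : Ω) :
    ‖{ω | R < ‖f ω‖ₑ}ᶜ.indicator f ω‖ₑ ≤ R := by
  by_cases h : R < ‖f ω‖ₑ
  · rw [indicator_of_notMem (s := {ω | R < ‖f ω‖ₑ}ᶜ) (fun hω => hω h), enorm_zero]
    exact zero_le
  · exact (enorm_indicator_le_enorm_self _ _).trans (not_lt.1 h)

lemma eLpNorm_sub_condExp_sq_le {m : MeasurableSpace Ω} (hm : m ≤ m0) {f : Ω → E}
    (hf : AEStronglyMeasurable[m0] f μ) [NormedSpace ℝ E] [CompleteSpace E] :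
    eLpNorm (f - μ[f | m]) 2 μ ^ 2 ≤ 4 * eLpNorm f 2 μ ^ 2 := by
  calc eLpNorm (f - μ[f | m]) 2 μ ^ 2 ≤ (eLpNorm f 2 μ + eLpNorm f 2 μ) ^ 2 := by
        gcongr
        exact (eLpNorm_sub_le hf (stronglyMeasurable_condExp.mono hm).aestronglyMeasurable
          one_le_two).trans (by gcongr; exact eLpNorm_condExp_le_eLpNorm _ one_le_two)
    _ = 4 * eLpNorm f 2 μ ^ 2 := by ring

lemma lintegral_enorm_sub_condExp_le [NormedSpace ℝ E] [CompleteSpace E] {m : MeasurableSpace Ω}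
    {f : Ω → E} (hf : AEStronglyMeasurable[m0] f μ) :
    ∫⁻ ω, ‖f ω - (μ[f | m]) ω‖ₑ ∂μ ≤ 2 * ∫⁻ ω, ‖f ω‖ₑ ∂μ := by
  calc ∫⁻ ω, ‖f ω - (μ[f | m]) ω‖ₑ ∂μ ≤ ∫⁻ ω, (‖f ω‖ₑ + ‖(μ[f | m]) ω‖ₑ) ∂μ :=
        lintegral_mono fun ω => enorm_sub_le
    _ = ∫⁻ ω, ‖f ω‖ₑ ∂μ + ∫⁻ ω, ‖(μ[f | m]) ω‖ₑ ∂μ := lintegral_add_left' hf.enorm _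
    _ ≤ 2 * ∫⁻ ω, ‖f ω‖ₑ ∂μ := by
        have h := eLpNorm_condExp_le_eLpNorm (μ := μ) (m := m) f le_rfl
        rw [eLpNorm_one_eq_lintegral_enorm, eLpNorm_one_eq_lintegral_enorm] at h
        rw [two_mul]
        gcongr

lemma sub_condExp_ae_eq_add_indicator_compl [NormedSpace ℝ E] [CompleteSpace E]
    (m : MeasurableSpace Ω) {f : Ω → E} (hf : Integrable f μ) {A : Set Ω}
    (hA : MeasurableSet[m0] A) :
    f - μ[f | m] =ᵐ[μ] (A.indicator f - μ[A.indicator f | m]) +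
      (Aᶜ.indicator f - μ[Aᶜ.indicator f | m]) := by
  have hadd : A.indicator f + Aᶜ.indicator f = f := indicator_self_add_compl A f
  filter_upwards [condExp_add (hf.indicator hA) (hf.indicator hA.compl) m] with ω hω
  rw [hadd] at hω
  nth_rewrite 1 [Pi.sub_apply, hω, ← hadd]
  simp only [Pi.add_apply, Pi.sub_apply]
  abel

variable [InnerProductSpace ℝ E]

lemma integral_inner_eq_zero_of_condExp_ae_eq_zero [CompleteSpace E] [IsFiniteMeasure μ]
    {m : MeasurableSpace Ω} (hm : m ≤ m0) {f g : Ω → E} (hf : StronglyMeasurable[m] f)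
    (hf2 : MemLp f 2 μ) (hg : MemLp g 2 μ) (hg0 : μ[g | m] =ᵐ[μ] 0) :
    ∫ ω, inner ℝ (f ω) (g ω) ∂μ = 0 := by
  have hfg : Integrable (fun ω => innerSL ℝ (f ω) (g ω)) μ := by
    refine (memLp_one_iff_integrable.1 (hf2.norm.mul hg.norm (r := 1))).mono
      (hf2.1.inner hg.1) (ae_of_all _ fun ω => ?_)
    simpa [mul_comm] using norm_inner_le_norm (𝕜 := ℝ) (f ω) (g ω)
  have h := condExp_bilin_of_stronglyMeasurable_left (innerSL ℝ) hf hfg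
    (hg.integrable one_le_two)
  calc ∫ ω, inner ℝ (f ω) (g ω) ∂μ
      = ∫ ω, (μ[fun ω => innerSL ℝ (f ω) (g ω) | m]) ω ∂μ := (integral_condExp hm).symm
    _ = ∫ _, (0 : ℝ) ∂μ := integral_congr_ae <| by
        filter_upwards [h, hg0] with ω h1 h2
        exact h1.trans (by simp [h2])
    _ = 0 := integral_zero _ _

lemma eLpNorm_two_add_sq_of_integral_inner_eq_zero {f g : Ω → E} (hf : MemLp f 2 μ)
    (hg : MemLp g 2 μ) (h : ∫ ω, inner ℝ (f ω) (g ω) ∂μ = 0) :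
    eLpNorm (f + g) 2 μ ^ 2 = eLpNorm f 2 μ ^ 2 + eLpNorm g 2 μ ^ 2 := by
  have horth : inner ℝ (hf.toLp f) (hg.toLp g) = 0 := by
    rw [L2.inner_def, ← h]
    refine integral_congr_ae ?_
    filter_upwards [hf.coeFn_toLp, hg.coeFn_toLp] with ω h1 h2
    rw [h1, h2]
  have hpyth := norm_add_sq_eq_norm_sq_add_norm_sq_of_inner_eq_zero _ _ horth
  rw [← MemLp.toLp_add, Lp.norm_toLp, Lp.norm_toLp, Lp.norm_toLp] at hpyth
  rw [← ENNReal.toReal_eq_toReal_iff' (by finiteness [(hf.add hg).2])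
    (by finiteness [hf.2, hg.2]), ENNReal.toReal_add (by finiteness [hf.2]) (by finiteness [hg.2])]
  simpa [sq] using hpyth

lemma eLpNorm_sum_sq_of_condExp_eq_zero [CompleteSpace E] [IsFiniteMeasure μ]
    (ℱ : Filtration ℕ m0) {D : ℕ → Ω → E} (hD : ∀ k, StronglyMeasurable[ℱ (k + 1)] (D k))
    (hD2 : ∀ k, MemLp (D k) 2 μ) (hD0 : ∀ k, μ[D k | ℱ k] =ᵐ[μ] 0) (n : ℕ) :
    eLpNorm (∑ k ∈ Finset.range n, D k) 2 μ ^ 2 =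
      ∑ k ∈ Finset.range n, eLpNorm (D k) 2 μ ^ 2 := by
  induction n with
  | zero => simp
  | succ n ih =>
    have hsum : StronglyMeasurable[ℱ n] (∑ k ∈ Finset.range n, D k) :=
      Finset.stronglyMeasurable_sum _ fun k hk =>
        (hD k).mono (ℱ.mono (Finset.mem_range.1 hk))
    have hsum2 : MemLp (∑ k ∈ Finset.range n, D k) 2 μ := memLp_finsetSum' _ fun k _ => hD2 k
    rw [Finset.sum_range_succ, Finset.sum_range_succ, ← ih]
    exact eLpNorm_two_add_sq_of_integral_inner_eq_zero hsum2 (hD2 n)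
      (integral_inner_eq_zero_of_condExp_ae_eq_zero (ℱ.le n) hsum hsum2 (hD2 n) (hD0 n))

lemma lintegral_enorm_sum_sub_condExp_le_of_bounded [CompleteSpace E] [IsProbabilityMeasure μ]
    (ℱ : Filtration ℕ m0) {Z : ℕ → Ω → E} (hZ : ∀ k, StronglyMeasurable[ℱ (k + 1)] (Z k))
    {R : NNReal} (hR : ∀ k ω, ‖Z k ω‖ₑ ≤ R) (n : ℕ) :
    ∫⁻ ω, ‖∑ k ∈ Finset.range n, (Z k ω - (μ[Z k | ℱ k]) ω)‖ₑ ∂μ ≤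
      2 * (R * ∑ k ∈ Finset.range n, ∫⁻ ω, ‖Z k ω‖ₑ ∂μ) ^ (1 / 2 : ℝ) := by
  have hZm : ∀ k, AEStronglyMeasurable (Z k) μ := fun k =>
    ((hZ k).mono (ℱ.le _)).aestronglyMeasurable
  have hZ2 : ∀ k, MemLp (Z k) 2 μ := fun k =>
    MemLp.of_bound (hZm k) R (ae_of_all _ fun ω => by exact_mod_cast hR k ω)
  let D : ℕ → Ω → E := fun k => Z k - μ[Z k | ℱ k]
  have hDm : ∀ k, StronglyMeasurable[ℱ (k + 1)] (D k) := fun k =>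
    (hZ k).sub (stronglyMeasurable_condExp.mono (ℱ.mono k.le_succ))
  have hD2 : ∀ k, MemLp (D k) 2 μ := fun k => (hZ2 k).sub ((hZ2 k).condExp one_le_two)
  have hD0 : ∀ k, μ[D k | ℱ k] =ᵐ[μ] 0 := fun k => by
    refine (condExp_sub ((hZ2 k).integrable one_le_two) integrable_condExp _).trans ?_
    rw [condExp_of_stronglyMeasurable (ℱ.le k) stronglyMeasurable_condExp integrable_condExp,
      sub_self]
  have hsq : eLpNorm (∑ k ∈ Finset.range n, D k) 2 μ ^ 2 ≤
      4 * (R * ∑ k ∈ Finset.range n, ∫⁻ ω, ‖Z k ω‖ₑ ∂μ) := by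
    rw [eLpNorm_sum_sq_of_condExp_eq_zero ℱ hDm hD2 hD0, Finset.mul_sum, Finset.mul_sum]
    exact Finset.sum_le_sum fun k _ => (eLpNorm_sub_condExp_sq_le (ℱ.le k) (hZm k)).trans
      (by gcongr; exact eLpNorm_two_sq_le_of_enorm_le (hR k))
  calc ∫⁻ ω, ‖∑ k ∈ Finset.range n, (Z k ω - (μ[Z k | ℱ k]) ω)‖ₑ ∂μ
      = eLpNorm (∑ k ∈ Finset.range n, D k) 1 μ := by
        simp [eLpNorm_one_eq_lintegral_enorm, D]
    _ ≤ eLpNorm (∑ k ∈ Finset.range n, D k) 2 μ :=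
        eLpNorm_le_eLpNorm_of_exponent_le one_le_two (memLp_finsetSum' _ fun k _ => hD2 k).1
    _ ≤ (4 * (R * ∑ k ∈ Finset.range n, ∫⁻ ω, ‖Z k ω‖ₑ ∂μ)) ^ (1 / 2 : ℝ) := by
        rw [one_div, ENNReal.le_rpow_inv_iff two_pos]
        exact_mod_cast hsq
    _ = 2 * (R * ∑ k ∈ Finset.range n, ∫⁻ ω, ‖Z k ω‖ₑ ∂μ) ^ (1 / 2 : ℝ) := by
        rw [ENNReal.mul_rpow_of_nonneg _ _ (by norm_num), show (4 : ENNReal) = 2 ^ (2 : ℝ) by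
          norm_num, ← ENNReal.rpow_mul]
        norm_num

/-- Only the part of the increments exceeding `R` escapes the `L²` orthogonality of martingale
differences. -/
lemma lintegral_enorm_sum_sub_condExp_le [CompleteSpace E] [IsProbabilityMeasure μ]
    (ℱ : Filtration ℕ m0) {X : ℕ → Ω → E} (hX : ∀ k, StronglyMeasurable[ℱ (k + 1)] (X k))
    (hXi : ∀ k, Integrable (X k) μ) (R : NNReal) (n : ℕ) :
    ∫⁻ ω, ‖∑ k ∈ Finset.range n, (X k ω - (μ[X k | ℱ k]) ω)‖ₑ ∂μ ≤
      2 * (R * ∑ k ∈ Finset.range n, ∫⁻ ω, ‖X k ω‖ₑ ∂μ) ^ (1 / 2 : ℝ) +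
        2 * ∑ k ∈ Finset.range n, ∫⁻ ω in {ω | R < ‖X k ω‖ₑ}, ‖X k ω‖ₑ ∂μ := by
  let A : ℕ → Set Ω := fun k => {ω | R < ‖X k ω‖ₑ}
  let Z : ℕ → Ω → E := fun k => (A k)ᶜ.indicator (X k)
  let B : ℕ → Ω → E := fun k => (A k).indicator (X k)
  have hA : ∀ k, MeasurableSet[ℱ (k + 1)] (A k) := fun k =>
    measurableSet_lt measurable_const (hX k).enorm
  have hBi : ∀ k, AEStronglyMeasurable (B k) μ := fun k => (hXi k).1.indicator (ℱ.le _ _ (hA k))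
  have hsplit : ∀ᵐ ω ∂μ, ∀ k, X k ω - (μ[X k | ℱ k]) ω =
      (B k ω - (μ[B k | ℱ k]) ω) + (Z k ω - (μ[Z k | ℱ k]) ω) := ae_all_iff.2 fun k =>
    sub_condExp_ae_eq_add_indicator_compl (ℱ k) (hXi k) (ℱ.le _ _ (hA k))
  have hBm : ∀ k, AEMeasurable (fun ω => ‖B k ω - (μ[B k | ℱ k]) ω‖ₑ) μ := fun k =>
    ((hBi k).sub (stronglyMeasurable_condExp.mono (ℱ.le k)).aestronglyMeasurable).enorm
  calc ∫⁻ ω, ‖∑ k ∈ Finset.range n, (X k ω - (μ[X k | ℱ k]) ω)‖ₑ ∂μ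
      ≤ ∫⁻ ω, (∑ k ∈ Finset.range n, ‖B k ω - (μ[B k | ℱ k]) ω‖ₑ +
          ‖∑ k ∈ Finset.range n, (Z k ω - (μ[Z k | ℱ k]) ω)‖ₑ) ∂μ := by
        refine lintegral_mono_ae (hsplit.mono fun ω hω => ?_)
        rw [Finset.sum_congr rfl fun k _ => hω k, Finset.sum_add_distrib]
        exact (enorm_add_le _ _).trans (by gcongr; exact enorm_sum_le _ _)
    _ = ∑ k ∈ Finset.range n, ∫⁻ ω, ‖B k ω - (μ[B k | ℱ k]) ω‖ₑ ∂μ +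
          ∫⁻ ω, ‖∑ k ∈ Finset.range n, (Z k ω - (μ[Z k | ℱ k]) ω)‖ₑ ∂μ := by
        rw [lintegral_add_left' (by fun_prop), lintegral_finsetSum' _ fun k _ => hBm k]
    _ ≤ ∑ k ∈ Finset.range n, 2 * ∫⁻ ω, ‖B k ω‖ₑ ∂μ +
          2 * (R * ∑ k ∈ Finset.range n, ∫⁻ ω, ‖X k ω‖ₑ ∂μ) ^ (1 / 2 : ℝ) := by
        gcongr with k
        · exact lintegral_enorm_sub_condExp_le (hBi k)
        · refine (lintegral_enorm_sum_sub_condExp_le_of_bounded ℱ (fun k =>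
            (hX k).indicator (hA k).compl) (fun k => enorm_indicator_compl_le (X k) R) n).trans ?_
          gcongr
          exact enorm_indicator_le_enorm_self _ _
    _ = _ := by
        simp only [B, A, enorm_indicator_eq_indicator_enorm,
          lintegral_indicator (ℱ.le _ _ (hA _)), ← Finset.mul_sum]
        exact add_comm _ _

end Martingale

section MarkovChain

lemma map_prodMap_compProd_comap {α β γ : Type*} [MeasurableSpace α] [MeasurableSpace β]
    [MeasurableSpace γ] (μ : Measure α) [SFinite μ] (κ : Kernel β γ) [IsSFiniteKernel κ]
    {f : α → β} (hf : Measurable f) :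
    (μ ⊗ₘ κ.comap f hf).map (Prod.map f id) = μ.map f ⊗ₘ κ := by
  ext s hs
  have hfs : Measurable (Prod.map f (id : γ → γ)) := hf.prodMap measurable_id
  rw [Measure.map_apply hfs hs, Measure.compProd_apply (hfs hs), Measure.compProd_apply hs,
    lintegral_map (Kernel.measurable_kernel_prodMk_left hs) hf]
  rfl

variable {S E : Type*} [MeasurableSpace S] [MeasurableSpace E] [StandardBorelSpace E] [Nonempty E]

/-- The law of the Markov chain which has the same initial law and the same transition
probabilities as the process `Y`; it forgets everything about `Y` but the joint laws of
`(Y n, Y (n + 1))`. -/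
noncomputable def markovLaw (P : Measure S) [IsFiniteMeasure P] (Y : ℕ → S → E) :
    Measure (ℕ → E) :=
  Kernel.trajMeasure (X := fun _ => E) (P.map (Y 0)) fun n =>
    (condDistrib (Y (n + 1)) (Y n) P).comap
      (fun z : (i : Finset.Iic n) → E => z ⟨n, Finset.mem_Iic.2 le_rfl⟩) (measurable_pi_apply _)

variable {P : Measure S} [IsProbabilityMeasure P] {Y : ℕ → S → E}

lemma isProbabilityMeasure_markovLaw (hY : ∀ n, Measurable (Y n)) :
    IsProbabilityMeasure (markovLaw P Y) := by
  have := Measure.isProbabilityMeasure_map (μ := P) (hY 0).aemeasurable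
  unfold markovLaw
  infer_instance

lemma map_markovLaw_zero (hY : ∀ n, Measurable (Y n)) :
    (markovLaw P Y).map (fun z => z 0) = P.map (Y 0) := by
  have := Measure.isProbabilityMeasure_map (μ := P) (hY 0).aemeasurable
  have hcomp : (fun z : ℕ → E => z 0) = (MeasurableEquiv.piUnique fun _ : Finset.Iic 0 => E) ∘
      Preorder.frestrictLe 0 := rfl
  rw [hcomp, ← Measure.map_map (by fun_prop) (by fun_prop), markovLaw, Kernel.trajMeasure,
    Measure.map_comp _ _ (by fun_prop), Kernel.traj_map_frestrictLe, Kernel.partialTraj_self,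
    Measure.id_comp, Measure.map_map (by fun_prop) (by fun_prop)]
  exact Measure.map_id

lemma map_pair_markovLaw_eq_compProd (hY : ∀ n, Measurable (Y n)) (n : ℕ) :
    (markovLaw P Y).map (fun z => (z n, z (n + 1))) =
      (markovLaw P Y).map (fun z => z n) ⊗ₘ condDistrib (Y (n + 1)) (Y n) P := by
  have := Measure.isProbabilityMeasure_map (μ := P) (hY 0).aemeasurable
  have := isProbabilityMeasure_markovLaw (P := P) hY
  have hlast : Measurable fun z : (i : Finset.Iic n) → E => z ⟨n, Finset.mem_Iic.2 le_rfl⟩ :=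
    measurable_pi_apply _
  have h := map_prodMap_compProd_comap ((markovLaw P Y).map (Preorder.frestrictLe n))
    (condDistrib (Y (n + 1)) (Y n) P) hlast
  rw [markovLaw, Kernel.map_frestrictLe_trajMeasure_compProd_eq_map_trajMeasure,
    Measure.map_map (hlast.prodMap measurable_id) (by fun_prop),
    Measure.map_map hlast (by fun_prop)] at h
  exact h

lemma map_markovLaw (hY : ∀ n, Measurable (Y n)) (n : ℕ) :
    (markovLaw P Y).map (fun z => z n) = P.map (Y n) := by
  induction n with
  | zero => exact map_markovLaw_zero hY
  | succ n ih =>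
    have h := congrArg Measure.snd (map_pair_markovLaw_eq_compProd (P := P) hY n)
    rwa [ih, compProd_map_condDistrib (hY _).aemeasurable,
      Measure.snd_map_prodMk (by fun_prop), Measure.snd_map_prodMk (hY n)] at h

lemma map_pair_markovLaw (hY : ∀ n, Measurable (Y n)) (n : ℕ) :
    (markovLaw P Y).map (fun z => (z n, z (n + 1))) = P.map (fun s => (Y n s, Y (n + 1) s)) := by
  rw [map_pair_markovLaw_eq_compProd hY, map_markovLaw hY,
    compProd_map_condDistrib (hY _).aemeasurable]

lemma lintegral_pair_markovLaw (hY : ∀ n, Measurable (Y n)) (n : ℕ) {g : E × E → ENNReal}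
    (hg : Measurable g) :
    ∫⁻ z, g (z n, z (n + 1)) ∂(markovLaw P Y) = ∫⁻ s, g (Y n s, Y (n + 1) s) ∂P := by
  rw [← lintegral_map (g := fun z : ℕ → E => (z n, z (n + 1))) hg (by fun_prop),
    map_pair_markovLaw hY, lintegral_map hg ((hY n).prodMk (hY (n + 1)))]

lemma condExp_markovLaw {F : Type*} [NormedAddCommGroup F] [NormedSpace ℝ F] [CompleteSpace F]
    (hY : ∀ n, Measurable (Y n)) (n : ℕ) {f : E × E → F} (hf : StronglyMeasurable f)
    (hfi : Integrable (fun z : ℕ → E => f (z n, z (n + 1))) (markovLaw P Y)) :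
    (markovLaw P Y)[fun z => f (z n, z (n + 1)) | Filtration.piLE (X := fun _ => E) n]
      =ᵐ[markovLaw P Y] fun z => ∫ e, f (z n, e) ∂(condDistrib (Y (n + 1)) (Y n) P (z n)) := by
  have := Measure.isProbabilityMeasure_map (μ := P) (hY 0).aemeasurable
  have := isProbabilityMeasure_markovLaw (P := P) hY
  rw [Filtration.piLE_eq_comap_frestrictLe]
  refine (condExp_prod_ae_eq_integral_condDistrib
    (f := fun p : ((i : Finset.Iic n) → E) × E => f (p.1 ⟨n, Finset.mem_Iic.2 le_rfl⟩, p.2))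
    (by fun_prop) (measurable_pi_apply (n + 1)).aemeasurable (hf.comp_measurable (by fun_prop))
    hfi).trans ?_
  have hκ := ae_of_ae_map (by fun_prop) (Kernel.condDistrib_trajMeasure (X := fun _ => E)
    (μ₀ := P.map (Y 0)) (a := n) (κ := fun n => (condDistrib (Y (n + 1)) (Y n) P).comap
      (fun z : (i : Finset.Iic n) → E => z ⟨n, Finset.mem_Iic.2 le_rfl⟩) (measurable_pi_apply _)))
  filter_upwards [hκ] with z hz
  exact congrArg (fun ν => ∫ e, f (z n, e) ∂ν) hz

end MarkovChain

section MarkovDrift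

variable {S E : Type*} [MeasurableSpace S] {P : Measure S} [IsProbabilityMeasure P]
  [NormedAddCommGroup E] [MeasurableSpace E] [BorelSpace E] [SecondCountableTopology E]
  [CompleteSpace E] {Y : ℕ → S → E}

lemma setLIntegral_increment_markovLaw (hY : ∀ n, Measurable (Y n)) (n : ℕ) (R : NNReal) :
    ∫⁻ z in {z | R < ‖z (n + 1) - z n‖ₑ}, ‖z (n + 1) - z n‖ₑ ∂(markovLaw P Y) =
      ∫⁻ s in {s | R < ‖Y (n + 1) s - Y n s‖ₑ}, ‖Y (n + 1) s - Y n s‖ₑ ∂P := by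
  have hlarge : MeasurableSet {p : E × E | R < ‖p.2 - p.1‖ₑ} :=
    measurableSet_lt measurable_const (by fun_prop)
  have hlargeY : MeasurableSet {s | R < ‖Y (n + 1) s - Y n s‖ₑ} :=
    (hY n).prodMk (hY (n + 1)) hlarge
  have hlargez : MeasurableSet {z : ℕ → E | R < ‖z (n + 1) - z n‖ₑ} :=
    measurableSet_lt measurable_const (by fun_prop)
  rw [← lintegral_indicator hlargeY, ← lintegral_indicator hlargez]
  exact lintegral_pair_markovLaw hY n
    (g := {p : E × E | R < ‖p.2 - p.1‖ₑ}.indicator fun p => ‖p.2 - p.1‖ₑ)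
    (Measurable.indicator (by fun_prop) hlarge)

lemma measurable_eval_piLE {E : Type*} [MeasurableSpace E] {i n : ℕ} (hi : i ≤ n) :
    Measurable[Filtration.piLE (X := fun _ : ℕ => E) n] fun z : ℕ → E => z i := by
  rw [Filtration.piLE_eq_comap_frestrictLe]
  exact (measurable_pi_apply (⟨i, Finset.mem_Iic.2 hi⟩ : Finset.Iic n)).comp
    (comap_measurable (Preorder.frestrictLe n))

lemma integrable_increment_markovLaw (hY : ∀ n, Measurable (Y n)) {n : ℕ}
    (hΔ : Integrable (fun s => Y (n + 1) s - Y n s) P) :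
    Integrable (fun z : ℕ → E => z (n + 1) - z n) (markovLaw P Y) := by
  refine ⟨by fun_prop, ?_⟩
  rw [hasFiniteIntegral_iff_enorm,
    lintegral_pair_markovLaw hY n (g := fun p => ‖p.2 - p.1‖ₑ) (by fun_prop)]
  exact hΔ.2

lemma lintegral_enorm_condExp_markovLaw_sub_le [NormedSpace ℝ E] (hY : ∀ n, Measurable (Y n))
    {n : ℕ} (hΔ : Integrable (fun s => Y (n + 1) s - Y n s) P) {V : S → E} (hV : Integrable V P)
    {c : E → E} (hc : Measurable c)
    (hVc : P[V | MeasurableSpace.comap (Y n) inferInstance] =ᵐ[P] fun s => c (Y n s)) :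
    ∫⁻ z, ‖((markovLaw P Y)[fun z => z (n + 1) - z n | Filtration.piLE (X := fun _ => E) n]) z -
        c (z n)‖ₑ ∂(markovLaw P Y) ≤ ∫⁻ s, ‖Y (n + 1) s - Y n s - V s‖ₑ ∂P := by
  let g : E → E := fun x => ∫ e, (e - x) ∂(condDistrib (Y (n + 1)) (Y n) P x)
  have hsub : StronglyMeasurable fun p : E × E => p.2 - p.1 := by fun_prop
  have hg : Measurable g := hsub.integral_condDistrib.measurable
  have hQ : (markovLaw P Y)[fun z => z (n + 1) - z n | Filtration.piLE (X := fun _ => E) n]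
      =ᵐ[markovLaw P Y] fun z => g (z n) :=
    condExp_markovLaw hY n (f := fun p => p.2 - p.1) hsub (integrable_increment_markovLaw hY hΔ)
  have hP : P[(fun s => Y (n + 1) s - Y n s) - V | MeasurableSpace.comap (Y n) inferInstance]
      =ᵐ[P] fun s => g (Y n s) - c (Y n s) := by
    refine (condExp_sub hΔ hV _).trans ?_
    filter_upwards [condExp_prod_ae_eq_integral_condDistrib (hY n) (hY (n + 1)).aemeasurable hsub
      hΔ, hVc] with s h1 h2
    rw [Pi.sub_apply, h1, h2]
  calc ∫⁻ z, ‖((markovLaw P Y)[fun z => z (n + 1) - z n |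
          Filtration.piLE (X := fun _ => E) n]) z - c (z n)‖ₑ ∂(markovLaw P Y)
      = ∫⁻ z, ‖g (z n) - c (z n)‖ₑ ∂(markovLaw P Y) :=
        lintegral_congr_ae (hQ.mono fun z hz => by simp only [hz])
    _ = ∫⁻ s, ‖g (Y n s) - c (Y n s)‖ₑ ∂P :=
        lintegral_pair_markovLaw hY n (g := fun p => ‖g p.1 - c p.1‖ₑ) (by fun_prop)
    _ = eLpNorm (P[(fun s => Y (n + 1) s - Y n s) - V |
          MeasurableSpace.comap (Y n) inferInstance]) 1 P := by
        rw [eLpNorm_one_eq_lintegral_enorm]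
        exact lintegral_congr_ae (hP.mono fun s hs => by simp only [hs])
    _ ≤ ∫⁻ s, ‖Y (n + 1) s - Y n s - V s‖ₑ ∂P := by
        rw [← eLpNorm_one_eq_lintegral_enorm]
        exact eLpNorm_condExp_le_eLpNorm _ le_rfl

/-- The martingale part of the chain is small because its increments are; the compensator is
compared with the increments of `Y` step by step. -/
lemma lintegral_enorm_markovLaw_sub_sum_le [InnerProductSpace ℝ E] (hY : ∀ n, Measurable (Y n))
    (hΔ : ∀ n, Integrable (fun s => Y (n + 1) s - Y n s) P) {V : ℕ → S → E}
    (hV : ∀ n, Integrable (V n) P) {c : ℕ → E → E} (hc : ∀ n, Measurable (c n))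
    (hVc : ∀ n, P[V n | MeasurableSpace.comap (Y n) inferInstance] =ᵐ[P] fun s => c n (Y n s))
    (R : NNReal) (n : ℕ) :
    ∫⁻ z, ‖z n - z 0 - ∑ k ∈ Finset.range n, c k (z k)‖ₑ ∂(markovLaw P Y) ≤
      2 * (R * ∑ k ∈ Finset.range n, ∫⁻ s, ‖Y (k + 1) s - Y k s‖ₑ ∂P) ^ (1 / 2 : ℝ) +
        2 * ∑ k ∈ Finset.range n,
          ∫⁻ s in {s | R < ‖Y (k + 1) s - Y k s‖ₑ}, ‖Y (k + 1) s - Y k s‖ₑ ∂P +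
        ∑ k ∈ Finset.range n, ∫⁻ s, ‖Y (k + 1) s - Y k s - V k s‖ₑ ∂P := by
  have := isProbabilityMeasure_markovLaw (P := P) hY
  let ℱ := Filtration.piLE (X := fun _ : ℕ => E)
  let X : ℕ → (ℕ → E) → E := fun k z => z (k + 1) - z k
  let C : ℕ → (ℕ → E) → E := fun k => (markovLaw P Y)[X k | ℱ k]
  have hX : ∀ k, StronglyMeasurable[ℱ (k + 1)] (X k) := fun k =>
    ((measurable_eval_piLE le_rfl).sub (measurable_eval_piLE k.le_succ)).stronglyMeasurable
  have hmart := lintegral_enorm_sum_sub_condExp_le ℱ hX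
    (fun k => integrable_increment_markovLaw hY (hΔ k)) R n
  have hCm : ∀ k, Measurable (C k) := fun k =>
    (stronglyMeasurable_condExp.mono (ℱ.le k)).measurable
  have hdecomp : ∀ z : ℕ → E, z n - z 0 - ∑ k ∈ Finset.range n, c k (z k) =
      ∑ k ∈ Finset.range n, (X k z - C k z) + ∑ k ∈ Finset.range n, (C k z - c k (z k)) := by
    intro z
    rw [← Finset.sum_range_sub, ← Finset.sum_sub_distrib, ← Finset.sum_add_distrib]
    exact Finset.sum_congr rfl fun k _ => by simp only [X]; abel
  calc ∫⁻ z, ‖z n - z 0 - ∑ k ∈ Finset.range n, c k (z k)‖ₑ ∂(markovLaw P Y)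
      ≤ ∫⁻ z, (‖∑ k ∈ Finset.range n, (X k z - C k z)‖ₑ +
          ∑ k ∈ Finset.range n, ‖C k z - c k (z k)‖ₑ) ∂(markovLaw P Y) := by
        refine lintegral_mono fun z => ?_
        rw [hdecomp]
        exact (enorm_add_le _ _).trans (by gcongr; exact enorm_sum_le _ _)
    _ = ∫⁻ z, ‖∑ k ∈ Finset.range n, (X k z - C k z)‖ₑ ∂(markovLaw P Y) +
          ∑ k ∈ Finset.range n, ∫⁻ z, ‖C k z - c k (z k)‖ₑ ∂(markovLaw P Y) := by
        rw [lintegral_add_left (by fun_prop), lintegral_finsetSum _ fun k _ => by fun_prop]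
    _ ≤ _ := by
        gcongr ?_ + ∑ k ∈ _, ?_ with k
        · refine hmart.trans (le_of_eq ?_)
          simp only [X, setLIntegral_increment_markovLaw hY,
            lintegral_pair_markovLaw hY _ (g := fun p => ‖p.2 - p.1‖ₑ) (by fun_prop)]
        · exact lintegral_enorm_condExp_markovLaw_sub_le hY (hΔ k) (hV k) (hc k) (hVc k)

end MarkovDrift

section DyadicGrid

/-- The point `k / 2ⁿ` of the dyadic grid. -/
def dyadicPt (n k : ℕ) : ℚ := (k : ℚ) / 2 ^ n

/-- The largest point of the grid `2⁻ⁿ ℕ` below `r`, and `0` if `r` is negative. -/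
noncomputable def dyadicFloor (n : ℕ) (r : ℝ) : ℚ := dyadicPt n ⌊r * 2 ^ n⌋₊

lemma coe_dyadicPt (n k : ℕ) : (dyadicPt n k : ℝ) = k / 2 ^ n := by
  simp only [dyadicPt, Rat.cast_div, Rat.cast_natCast, Rat.cast_pow, Rat.cast_ofNat]

lemma dyadicPt_zero_right (n : ℕ) : dyadicPt n 0 = 0 := by
  simp only [dyadicPt, Nat.cast_zero, zero_div]

lemma monotone_dyadicPt (n : ℕ) : Monotone fun k => (dyadicPt n k : ℝ) := by
  intro i j hij
  simp only [coe_dyadicPt]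
  gcongr

lemma dyadicPt_succ_sub (n k : ℕ) : (dyadicPt n (k + 1) : ℝ) - dyadicPt n k = (1 / 2) ^ n := by
  rw [coe_dyadicPt, coe_dyadicPt, ← sub_div, Nat.cast_succ, add_sub_cancel_left, one_div_pow]

lemma floor_dyadicPt (n k : ℕ) : ⌊(dyadicPt n k : ℝ) * 2 ^ n⌋₊ = k := by
  rw [coe_dyadicPt, div_mul_cancel₀ _ (by positivity), Nat.floor_natCast]

lemma exists_dyadicPt_eq {m n : ℕ} (h : m ≤ n) (k : ℕ) : ∃ j, dyadicPt n j = dyadicPt m k := by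
  refine ⟨k * 2 ^ (n - m), ?_⟩
  rw [dyadicPt, dyadicPt, div_eq_div_iff (by positivity) (by positivity)]
  push_cast
  rw [mul_assoc, ← pow_add, Nat.sub_add_cancel h]

lemma dyadicFloor_dyadicPt {m n : ℕ} (h : m ≤ n) (k : ℕ) :
    dyadicFloor n (dyadicPt m k) = dyadicPt m k := by
  obtain ⟨j, hj⟩ := exists_dyadicPt_eq h k
  rw [← hj, dyadicFloor, floor_dyadicPt]

lemma dyadicFloor_dyadicFloor {m n : ℕ} (h : m ≤ n) (r : ℝ) :
    dyadicFloor n (dyadicFloor m r) = dyadicFloor m r := dyadicFloor_dyadicPt h _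

lemma dyadicFloor_of_mem_Ico {n k : ℕ} {r : ℝ}
    (hr : r ∈ Ico (dyadicPt n k : ℝ) (dyadicPt n (k + 1))) : dyadicFloor n r = dyadicPt n k := by
  have h2 : (0 : ℝ) < 2 ^ n := by positivity
  rw [coe_dyadicPt, coe_dyadicPt, mem_Ico, div_le_iff₀ h2, lt_div_iff₀ h2, Nat.cast_succ] at hr
  rw [dyadicFloor, (Nat.floor_eq_iff ((Nat.cast_nonneg k).trans hr.1)).2 hr]

@[fun_prop]
lemma measurable_dyadicFloor (n : ℕ) : Measurable (dyadicFloor n) :=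
  (measurable_from_nat (f := dyadicPt n)).comp (Nat.measurable_floor.comp (by fun_prop))

lemma dyadicFloor_nonneg (n : ℕ) (r : ℝ) : (0 : ℝ) ≤ dyadicFloor n r := by
  rw [dyadicFloor, coe_dyadicPt]; positivity

lemma dyadicFloor_le (n : ℕ) {r : ℝ} (hr : 0 ≤ r) : (dyadicFloor n r : ℝ) ≤ r := by
  rw [dyadicFloor, coe_dyadicPt, div_le_iff₀ (by positivity)]
  exact Nat.floor_le (by positivity)

lemma lt_dyadicFloor_add (n : ℕ) (r : ℝ) : r < dyadicFloor n r + (1 / 2) ^ n := by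
  rw [dyadicFloor, coe_dyadicPt, one_div, inv_pow, ← one_div, ← add_div,
    lt_div_iff₀ (by positivity)]
  exact Nat.lt_floor_add_one _

lemma monotone_dyadicFloor (n : ℕ) : Monotone fun r => (dyadicFloor n r : ℝ) := fun _ _ h =>
  monotone_dyadicPt n (Nat.floor_mono (by gcongr))

lemma monotone_dyadicFloor_left {r : ℝ} (hr : 0 ≤ r) :
    Monotone fun n => (dyadicFloor n r : ℝ) := fun m n h => by
  have hle : (dyadicFloor n (dyadicFloor m r) : ℝ) ≤ dyadicFloor n r :=
    monotone_dyadicFloor n (dyadicFloor_le m hr)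
  rwa [dyadicFloor_dyadicFloor h] at hle

lemma abs_dyadicFloor_sub_le (n : ℕ) {r : ℝ} (hr : 0 ≤ r) :
    |(dyadicFloor n r : ℝ) - r| ≤ (1 / 2) ^ n := by
  rw [abs_le]
  constructor <;> linarith [dyadicFloor_le n hr, lt_dyadicFloor_add n r,
    pow_nonneg (by norm_num : (0 : ℝ) ≤ 1 / 2) n]

lemma tendsto_dyadicFloor {r : ℝ} (hr : 0 ≤ r) :
    Tendsto (fun n => (dyadicFloor n r : ℝ)) atTop (𝓝 r) := by
  rw [tendsto_iff_norm_sub_tendsto_zero]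
  exact squeeze_zero (fun n => norm_nonneg _) (fun n => abs_dyadicFloor_sub_le n hr)
    (tendsto_pow_atTop_nhds_zero_of_lt_one (by norm_num) (by norm_num))

section StepFunction

lemma eqOn_comp_dyadicFloor {E : Type*} (n : ℕ) (g : ℚ → E) (k : ℕ) :
    EqOn (fun _ => g (dyadicPt n k)) (fun u => g (dyadicFloor n u))
      (Ioo (dyadicPt n k : ℝ) (dyadicPt n (k + 1))) := fun u hu => by
  simp only [dyadicFloor_of_mem_Ico (Ioo_subset_Ico_self hu)]

variable {E : Type*} [NormedAddCommGroup E] (n : ℕ) (g : ℚ → E)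

lemma intervalIntegrable_comp_dyadicFloor_succ (k : ℕ) :
    IntervalIntegrable (fun u => g (dyadicFloor n u)) volume
      (dyadicPt n k) (dyadicPt n (k + 1)) := by
  rw [intervalIntegrable_iff_integrableOn_Ioo_of_le (monotone_dyadicPt n k.le_succ)]
  exact (integrableOn_const (by simp)).congr_fun (eqOn_comp_dyadicFloor n g k) measurableSet_Ioo

lemma intervalIntegrable_comp_dyadicFloor (N : ℕ) :
    IntervalIntegrable (fun u => g (dyadicFloor n u)) volume 0 (dyadicPt n N) := by
  have h := IntervalIntegrable.trans_iterate (n := N) fun k _ =>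
    intervalIntegrable_comp_dyadicFloor_succ n g k
  rwa [dyadicPt_zero_right, Rat.cast_zero] at h

lemma integral_comp_dyadicFloor [NormedSpace ℝ E] [CompleteSpace E] (N : ℕ) :
    ∫ u in (0 : ℝ)..dyadicPt n N, g (dyadicFloor n u) =
      ∑ k ∈ Finset.range N, (1 / 2 : ℝ) ^ n • g (dyadicPt n k) := by
  have h := intervalIntegral.sum_integral_adjacent_intervals (n := N) fun k _ =>
    intervalIntegrable_comp_dyadicFloor_succ n g k
  rw [dyadicPt_zero_right, Rat.cast_zero] at h
  rw [← h]
  refine Finset.sum_congr rfl fun k _ => ?_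
  rw [intervalIntegral.integral_of_le (monotone_dyadicPt n k.le_succ),
    integral_Ioc_eq_integral_Ioo,
    ← setIntegral_congr_fun measurableSet_Ioo (eqOn_comp_dyadicFloor n g k), setIntegral_const,
    measureReal_def, Real.volume_Ioo, dyadicPt_succ_sub, ENNReal.toReal_ofReal (by positivity)]

end StepFunction

lemma sum_setLIntegral_Ico {t : ℕ → ℝ} (ht : Monotone t) (g : ℝ → ENNReal) {i j : ℕ}
    (hij : i ≤ j) :
    ∑ k ∈ Finset.Ico i j, ∫⁻ r in Ico (t k) (t (k + 1)), g r = ∫⁻ r in Ico (t i) (t j), g r := by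
  induction j, hij using Nat.le_induction with
  | base => simp
  | succ j hij ih =>
    rw [Finset.sum_Ico_succ_top hij, ih, ← lintegral_union measurableSet_Ico,
      Ico_union_Ico_eq_Ico (ht hij) (ht j.le_succ)]
    exact Set.disjoint_left.2 fun x hx hx' => absurd hx'.1 (not_le.2 hx.2)

lemma lintegral_lintegral_Ico_dyadicFloor_le {α : ℝ → ENNReal} (hα : Measurable α) (n : ℕ)
    (T : ℝ) :
    ∫⁻ u in Icc 0 T, ∫⁻ v in Ico (dyadicFloor n u : ℝ) u, α v ≤
      ENNReal.ofReal ((1 / 2) ^ n) * ∫⁻ v, α v := by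
  have hmeas : MeasurableSet {p : ℝ × ℝ | p.2 < p.1 ∧ p.1 ≤ p.2 + (1 / 2) ^ n} :=
    (measurableSet_lt measurable_snd measurable_fst).inter
      (measurableSet_le measurable_fst (by fun_prop))
  calc ∫⁻ u in Icc 0 T, ∫⁻ v in Ico (dyadicFloor n u : ℝ) u, α v
      ≤ ∫⁻ u in Icc 0 T, ∫⁻ v, (Ioc v (v + (1 / 2) ^ n)).indicator (fun _ => α v) u := by
        refine lintegral_mono fun u => ?_
        rw [← lintegral_indicator measurableSet_Ico]
        refine lintegral_mono <| Set.indicator_le fun v hv => ?_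
        rw [indicator_of_mem]
        exact ⟨hv.2, (lt_dyadicFloor_add n u).le.trans (by gcongr; exact hv.1)⟩
    _ ≤ ∫⁻ u, ∫⁻ v, (Ioc v (v + (1 / 2) ^ n)).indicator (fun _ => α v) u :=
        setLIntegral_le_lintegral _ _
    _ = ∫⁻ v, ∫⁻ u, (Ioc v (v + (1 / 2) ^ n)).indicator (fun _ => α v) u :=
        lintegral_lintegral_swap
          ((hα.comp measurable_snd).indicator hmeas).aemeasurable
    _ = ENNReal.ofReal ((1 / 2) ^ n) * ∫⁻ v, α v := by
        rw [← lintegral_const_mul _ hα]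
        refine lintegral_congr fun v => ?_
        rw [lintegral_indicator_const measurableSet_Ioc, Real.volume_Ioc, add_sub_cancel_left,
          mul_comm]

end DyadicGrid

section ShiftedGrid

lemma exists_strictMono_ae_tendsto_zero_of_tendsto_lintegral {α : Type*} [MeasurableSpace α]
    {μ : Measure α} {G : ℕ → α → ENNReal} (hG : ∀ n, Measurable (G n))
    (hlim : Tendsto (fun n => ∫⁻ a, G n a ∂μ) atTop (𝓝 0)) :
    ∃ φ : ℕ → ℕ, StrictMono φ ∧ ∀ᵐ a ∂μ, Tendsto (fun n => G (φ n) a) atTop (𝓝 0) := by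
  obtain ⟨φ, hφ, hφle⟩ := extraction_forall_of_eventually'
    (P := fun n k => ∫⁻ a, G k a ∂μ ≤ 2⁻¹ ^ n)
    (fun n => eventually_atTop.1 (ENNReal.tendsto_nhds_zero.1 hlim _ (ENNReal.pow_pos (by simp) n)))
  have hsum : ∫⁻ a, ∑' n, G (φ n) a ∂μ ≠ ⊤ := by
    rw [lintegral_tsum fun n => (hG (φ n)).aemeasurable]
    refine ne_top_of_le_ne_top ?_ (ENNReal.tsum_le_tsum hφle)
    rw [ENNReal.tsum_geometric]
    simp
  refine ⟨φ, hφ, ?_⟩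
  filter_upwards [ae_lt_top (Measurable.tsum fun n => hG (φ n)) hsum] with a ha
  exact ENNReal.tendsto_atTop_zero_of_tsum_ne_top ha.ne

variable {F : Type*} [NormedAddCommGroup F]

lemma tendsto_lintegral_translate_sub {f : ℝ → F} (hf : Integrable f) :
    Tendsto (fun δ : ℝ => ∫⁻ x, ‖f (x + δ) - f x‖ₑ) (𝓝 0) (𝓝 0) := by
  have hfm : MemLp f 1 volume := memLp_one_iff_integrable.2 hf
  let g : C(ℝ, C(ℝ, ℝ)) := (ContinuousMap.mk (fun p : ℝ × ℝ => p.2 + p.1) (by fun_prop)).curry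
  have hg : ∀ δ, MeasurePreserving (g δ) (volume : Measure ℝ) volume := fun δ =>
    measurePreserving_add_right volume δ
  have hLp := Filter.Tendsto.compMeasurePreservingLp (l := 𝓝 (0 : ℝ))
    (tendsto_const_nhds (x := hfm.toLp f)) (g.continuous.tendsto 0) hg (hg 0) ENNReal.one_ne_top
  refine (tendsto_iff_edist_tendsto_0.1 hLp).congr fun δ => ?_
  rw [Lp.toLp_compMeasurePreserving hfm (hg δ), Lp.toLp_compMeasurePreserving hfm (hg 0),
    Lp.edist_toLp_toLp, eLpNorm_one_eq_lintegral_enorm]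
  simp [g]

variable [MeasurableSpace F] [BorelSpace F] [SecondCountableTopology F] {S : Type*}
  [MeasurableSpace S] {P : Measure S} {f : S → ℝ → F}

lemma tendsto_lintegral_lintegral_translate_sub (hf : Measurable fun p : S × ℝ => f p.1 p.2)
    (hfin : ∫⁻ s, (∫⁻ x, ‖f s x‖ₑ) ∂P ≠ ⊤) :
    Tendsto (fun δ : ℝ => ∫⁻ s, (∫⁻ x, ‖f s (x + δ) - f s x‖ₑ) ∂P) (𝓝 0) (𝓝 0) := by
  have hnorm : Measurable fun s => ∫⁻ x, ‖f s x‖ₑ := hf.enorm.lintegral_prod_right'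
  have hmeas : ∀ δ : ℝ, Measurable fun s => ∫⁻ x, ‖f s (x + δ) - f s x‖ₑ := fun δ =>
    Measurable.lintegral_prod_right' (f := fun p : S × ℝ => ‖f p.1 (p.2 + δ) - f p.1 p.2‖ₑ)
      ((hf.comp (g := fun p : S × ℝ => f p.1 p.2) (f := fun p : S × ℝ => (p.1, p.2 + δ))
        (by fun_prop)).sub hf).enorm
  have hbound : ∀ (δ : ℝ) s, ∫⁻ x, ‖f s (x + δ) - f s x‖ₑ ≤ 2 * ∫⁻ x, ‖f s x‖ₑ := fun δ s =>
    calc ∫⁻ x, ‖f s (x + δ) - f s x‖ₑ ≤ ∫⁻ x, (‖f s (x + δ)‖ₑ + ‖f s x‖ₑ) :=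
          lintegral_mono fun x => enorm_sub_le
      _ = 2 * ∫⁻ x, ‖f s x‖ₑ := by
          rw [lintegral_add_right _ (by exact (hf.comp measurable_prodMk_left).enorm),
            lintegral_add_right_eq_self (fun x => ‖f s x‖ₑ) δ, two_mul]
  have hlim : ∀ᵐ s ∂P, Tendsto (fun δ : ℝ => ∫⁻ x, ‖f s (x + δ) - f s x‖ₑ) (𝓝 0) (𝓝 0) := by
    filter_upwards [ae_lt_top hnorm hfin] with s hs
    exact tendsto_lintegral_translate_sub
      ⟨(hf.comp measurable_prodMk_left).aestronglyMeasurable, hs⟩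
  have hfin2 : ∫⁻ s, 2 * (∫⁻ x, ‖f s x‖ₑ) ∂P ≠ ⊤ := by
    rw [lintegral_const_mul _ hnorm]
    exact ENNReal.mul_ne_top (by simp) hfin
  simpa using tendsto_lintegral_filter_of_dominated_convergence (μ := P) (l := 𝓝 (0 : ℝ))
    (fun s => 2 * ∫⁻ x, ‖f s x‖ₑ) (Eventually.of_forall hmeas)
    (Eventually.of_forall fun δ => ae_of_all _ (hbound δ)) hfin2 hlim

/-- The `L¹` distance, on the time window `[0, T]`, between the process `f` delayed by `U` and its
step approximation along the dyadic grid. -/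
noncomputable def stepError (P : Measure S) (f : S → ℝ → F) (T : ℝ) (n : ℕ) (U : ℝ) : ENNReal :=
  ∫⁻ r in Icc 0 T, ∫⁻ s, ‖f s (dyadicFloor n r - U) - f s (r - U)‖ₑ ∂P

variable [SFinite P]

lemma measurable_stepError_integrand (hf : Measurable fun p : S × ℝ => f p.1 p.2) (n : ℕ) :
    Measurable fun p : (ℝ × ℝ) × S =>
      ‖f p.2 (dyadicFloor n p.1.2 - p.1.1) - f p.2 (p.1.2 - p.1.1)‖ₑ :=
  ((hf.comp (g := fun p : S × ℝ => f p.1 p.2)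
      (f := fun p : (ℝ × ℝ) × S => (p.2, (dyadicFloor n p.1.2 : ℝ) - p.1.1)) (by fun_prop)).sub
    (hf.comp (g := fun p : S × ℝ => f p.1 p.2)
      (f := fun p : (ℝ × ℝ) × S => (p.2, p.1.2 - p.1.1)) (by fun_prop))).enorm

lemma measurable_stepError (hf : Measurable fun p : S × ℝ => f p.1 p.2) (T : ℝ) (n : ℕ) :
    Measurable (stepError P f T n) :=
  (measurable_stepError_integrand hf n).lintegral_prod_right'.lintegral_prod_right'

lemma lintegral_stepError_le (hf : Measurable fun p : S × ℝ => f p.1 p.2) {T : ℝ} {n : ℕ}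
    {ε : ENNReal} (hε : ∀ δ : ℝ, |δ| ≤ (1 / 2) ^ n →
      ∫⁻ s, (∫⁻ x, ‖f s (x + δ) - f s x‖ₑ) ∂P ≤ ε) :
    ∫⁻ U, stepError P f T n U ≤ ε * ENNReal.ofReal T := by
  have hmeas := measurable_stepError_integrand hf n
  calc ∫⁻ U, stepError P f T n U
      = ∫⁻ r in Icc 0 T, ∫⁻ U, ∫⁻ s, ‖f s (dyadicFloor n r - U) - f s (r - U)‖ₑ ∂P :=
        lintegral_lintegral_swap hmeas.lintegral_prod_right'.aemeasurable
    _ ≤ ∫⁻ _ in Icc 0 T, ε := by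
        refine setLIntegral_mono' measurableSet_Icc fun r hr => ?_
        refine le_trans (le_of_eq ?_) (hε _ (abs_dyadicFloor_sub_le n hr.1))
        rw [lintegral_lintegral_swap (by exact (hmeas.comp (by fun_prop :
          Measurable fun p : ℝ × S => ((p.1, r), p.2))).aemeasurable)]
        refine lintegral_congr fun s => ?_
        rw [← lintegral_sub_left_eq_self _ r]
        exact lintegral_congr fun x => by congr 3 <;> ring_nf
    _ = ε * ENNReal.ofReal T := by simp

lemma tendsto_lintegral_stepError (hf : Measurable fun p : S × ℝ => f p.1 p.2)
    (hfin : ∫⁻ s, (∫⁻ x, ‖f s x‖ₑ) ∂P ≠ ⊤) (T : ℝ) :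
    Tendsto (fun n => ∫⁻ U, stepError P f T n U) atTop (𝓝 0) := by
  rw [ENNReal.tendsto_nhds_zero]
  intro ε hε
  obtain ⟨ρ, hρ, hball⟩ := Metric.eventually_nhds_iff.1
    (ENNReal.tendsto_nhds_zero.1 (tendsto_lintegral_lintegral_translate_sub hf hfin)
      (ε / ENNReal.ofReal T) (ENNReal.div_pos hε.ne' ENNReal.ofReal_ne_top))
  filter_upwards [(tendsto_pow_atTop_nhds_zero_of_lt_one (by norm_num : (0 : ℝ) ≤ 1 / 2)
    (by norm_num)).eventually_lt_const hρ] with n hn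
  refine (lintegral_stepError_le hf fun δ hδ => hball ?_).trans ?_
  · simpa [Real.dist_eq] using hδ.trans_lt hn
  · rw [mul_comm]
    exact ENNReal.mul_div_le

lemma exists_shift_tendsto_stepError {g : S → ℝ → F} (hf : Measurable fun p : S × ℝ => f p.1 p.2)
    (hffin : ∫⁻ s, (∫⁻ x, ‖f s x‖ₑ) ∂P ≠ ⊤) (hg : Measurable fun p : S × ℝ => g p.1 p.2)
    (hgfin : ∫⁻ s, (∫⁻ x, ‖g s x‖ₑ) ∂P ≠ ⊤) (T : ℝ) {p : ℝ → Prop} (hp : ∀ᵐ t, p t) :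
    ∃ U ∈ Icc (0 : ℝ) 1, (∀ q : ℚ, p (q - U)) ∧ ∃ φ : ℕ → ℕ, Tendsto φ atTop atTop ∧
      Tendsto (fun n => stepError P f T (φ n) U) atTop (𝓝 0) ∧
      Tendsto (fun n => stepError P g T (φ n) U) atTop (𝓝 0) := by
  have hlim := (tendsto_lintegral_stepError hf hffin T).add
    (tendsto_lintegral_stepError hg hgfin T)
  simp only [← lintegral_add_left (measurable_stepError (P := P) hf T _), add_zero] at hlim
  obtain ⟨φ, hφ, hsum⟩ := exists_strictMono_ae_tendsto_zero_of_tendsto_lintegral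
    (fun n => (measurable_stepError hf T n).add (measurable_stepError hg T n)) hlim
  have hgrid : ∀ᵐ U, ∀ q : ℚ, p (q - U) := ae_all_iff.2 fun q =>
    (Measure.measurePreserving_sub_left volume (q : ℝ)).quasiMeasurePreserving.ae hp
  have : NeBot (ae (volume.restrict (Icc (0 : ℝ) 1))) := ae_neBot.2 (by simp)
  obtain ⟨U, ⟨hU, hpU⟩, hsumU⟩ :=
    (((ae_restrict_mem (measurableSet_Icc (a := (0 : ℝ)) (b := 1))).and
      (ae_restrict_of_ae hgrid)).and (ae_restrict_of_ae hsum)).exists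
  refine ⟨U, hU, hpU, φ, hφ.tendsto_atTop, ?_, ?_⟩ <;>
    refine tendsto_of_tendsto_of_tendsto_of_le_of_le tendsto_const_nhds hsumU (fun _ => bot_le) ?_
  exacts [fun n => le_self_add, fun n => le_add_self]

end ShiftedGrid

section Velocity

lemma sum_setLIntegral_le_lintegral_indicator_iUnion {α ι : Type*} [MeasurableSpace α]
    {μ : Measure α} {f : ι → α → ENNReal} {V : α → ENNReal} {A : ι → Set α}
    (hf : ∀ i, Measurable (f i)) (hA : ∀ i, MeasurableSet (A i)) {t : Finset ι}
    (hV : ∀ x, ∑ i ∈ t, f i x ≤ V x) :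
    ∑ i ∈ t, ∫⁻ x in A i, f i x ∂μ ≤ ∫⁻ x, (⋃ i, A i).indicator V x ∂μ := by
  simp only [← lintegral_indicator (hA _)]
  rw [← lintegral_finsetSum _ fun i _ => (hf i).indicator (hA i)]
  refine lintegral_mono fun x => ?_
  by_cases hx : x ∈ ⋃ i, A i
  · rw [indicator_of_mem hx]
    exact (Finset.sum_le_sum fun i _ => indicator_le_self _ _ x).trans (hV x)
  · rw [Finset.sum_eq_zero fun i _ => indicator_of_notMem (fun hi => hx (mem_iUnion.2 ⟨i, hi⟩)) _]
    exact bot_le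

variable {S : Type*} [MeasurableSpace S] {E : Type*} [NormedAddCommGroup E] [NormedSpace ℝ E]
  [MeasurableSpace E]

/-- A process `y` whose sample paths are primitives of the sample paths of the velocity `w`, which
is integrable over all parameters and all times. -/
structure HasVelocity (P : Measure S) (y w : S → ℝ → E) : Prop where
  measurable_position : Measurable fun p : S × ℝ => y p.1 p.2
  measurable_velocity : Measurable fun p : S × ℝ => w p.1 p.2
  integrable_velocity : ∀ s, Integrable (w s)
  integral_velocity : ∀ s a b, y s b - y s a = ∫ r in a..b, w s r
  lintegral_velocity_ne_top : ∫⁻ s, (∫⁻ r, ‖w s r‖ₑ) ∂P ≠ ⊤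

/-- At time `t`, the mean velocity given the position `y t` is the value of the field `b t` there.
Integrability is part of the definition because a conditional expectation has the junk value `0`
otherwise. -/
structure HasMeanVelocityAt (P : Measure S) (y w : S → ℝ → E) (b : ℝ → E → E) (t : ℝ) :
    Prop where
  integrable : Integrable (fun s => w s t) P
  condExp_ae_eq : P[fun s => w s t | MeasurableSpace.comap (fun s => y s t) inferInstance] =ᵐ[P]
    fun s => b t (y s t)

lemma HasMeanVelocityAt.lintegral_field_le [CompleteSpace E] {P : Measure S} {y w : S → ℝ → E}
    {b : ℝ → E → E} {t : ℝ} (h : HasMeanVelocityAt P y w b t) :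
    ∫⁻ s, ‖b t (y s t)‖ₑ ∂P ≤ ∫⁻ s, ‖w s t‖ₑ ∂P := by
  rw [← eLpNorm_one_eq_lintegral_enorm, ← eLpNorm_one_eq_lintegral_enorm,
    ← eLpNorm_congr_ae h.condExp_ae_eq]
  exact eLpNorm_condExp_le_eLpNorm _ le_rfl

namespace HasVelocity

variable {P : Measure S} {y w : S → ℝ → E}

lemma measurable_position_at (h : HasVelocity P y w) (r : ℝ) : Measurable fun s => y s r :=
  h.measurable_position.comp (by fun_prop : Measurable fun s : S => (s, r))

lemma continuous_position (h : HasVelocity P y w) (s : S) : Continuous (y s) := by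
  have heq : y s = fun r => y s 0 + ∫ u in (0 : ℝ)..r, w s u := funext fun r => by
    rw [← h.integral_velocity, add_sub_cancel]
  rw [heq]
  exact continuous_const.add (intervalIntegral.continuous_primitive
    (fun _ _ => (h.integrable_velocity s).intervalIntegrable) 0)

lemma enorm_position_sub_le (h : HasVelocity P y w) (s : S) {r r' : ℝ} (hr : r ≤ r') :
    ‖y s r' - y s r‖ₑ ≤ ∫⁻ u in Ico r r', ‖w s u‖ₑ := by
  rw [h.integral_velocity, intervalIntegral.integral_of_le hr, setLIntegral_congr Ico_ae_eq_Ioc]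
  exact enorm_integral_le_lintegral_enorm _

/-- This is the absolute continuity of the integral of `w s`. -/
lemma eventually_forall_dyadicPt_enorm_le (h : HasVelocity P y w) (s : S) {R : ENNReal}
    (hR : 0 < R) :
    ∀ᶠ n in atTop, ∀ k, ‖y s (dyadicPt n (k + 1)) - y s (dyadicPt n k)‖ₑ ≤ R := by
  obtain ⟨δ, hδ, hsmall⟩ := exists_pos_setLIntegral_lt_of_measure_lt
    (h.integrable_velocity s).2.ne hR.ne'
  have hgrid : Tendsto (fun n : ℕ => ENNReal.ofReal ((1 / 2) ^ n)) atTop (𝓝 0) := by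
    simpa using ENNReal.tendsto_ofReal
      (tendsto_pow_atTop_nhds_zero_of_lt_one (by norm_num : (0 : ℝ) ≤ 1 / 2) (by norm_num))
  filter_upwards [hgrid.eventually_lt_const hδ] with n hn k
  refine (h.enorm_position_sub_le s (monotone_dyadicPt n k.le_succ)).trans (hsmall _ ?_).le
  rwa [Real.volume_Ico, dyadicPt_succ_sub]

lemma sum_enorm_dyadicPt_sub_le (h : HasVelocity P y w) (s : S) (n N : ℕ) :
    ∑ k ∈ Finset.range N, ‖y s (dyadicPt n (k + 1)) - y s (dyadicPt n k)‖ₑ ≤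
      ∫⁻ u, ‖w s u‖ₑ := by
  refine (Finset.sum_le_sum fun k _ =>
    h.enorm_position_sub_le s (monotone_dyadicPt n k.le_succ)).trans ?_
  rw [Finset.range_eq_Ico, sum_setLIntegral_Ico (monotone_dyadicPt n) _ N.zero_le]
  exact setLIntegral_le_lintegral _ _

variable [BorelSpace E] [SFinite P]

lemma lintegral_position_sub_le (h : HasVelocity P y w) {r r' : ℝ} (hr : r ≤ r') :
    ∫⁻ s, ‖y s r' - y s r‖ₑ ∂P ≤ ∫⁻ u in Ico r r', ∫⁻ s, ‖w s u‖ₑ ∂P :=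
  (lintegral_mono fun s => h.enorm_position_sub_le s hr).trans_eq
    (lintegral_lintegral_swap h.measurable_velocity.enorm.aemeasurable)

lemma lintegral_lintegral_velocity_ne_top (h : HasVelocity P y w) :
    ∫⁻ u, ∫⁻ s, ‖w s u‖ₑ ∂P ≠ ⊤ := by
  rw [← lintegral_lintegral_swap h.measurable_velocity.enorm.aemeasurable]
  exact h.lintegral_velocity_ne_top

lemma measurable_lintegral_velocity (h : HasVelocity P y w) :
    Measurable fun u => ∫⁻ s, ‖w s u‖ₑ ∂P :=
  (h.measurable_velocity.comp measurable_swap).enorm.lintegral_prod_right'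

variable [SecondCountableTopology E]

lemma integrable_position_sub (h : HasVelocity P y w) {r r' : ℝ} (hr : r ≤ r') :
    Integrable (fun s => y s r' - y s r) P :=
  ⟨((h.measurable_position_at r').sub (h.measurable_position_at r)).aestronglyMeasurable,
    (h.lintegral_position_sub_le hr).trans_lt ((setLIntegral_le_lintegral _ _).trans_lt
      h.lintegral_lintegral_velocity_ne_top.lt_top)⟩

omit [SFinite P] in
lemma tendsto_sum_setLIntegral_large_increments (h : HasVelocity P y w) {R : NNReal}
    (hR : 0 < R) (N : ℕ → ℕ) :
    Tendsto (fun n => ∑ k ∈ Finset.range (N n),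
      ∫⁻ s in {s | R < ‖y s (dyadicPt n (k + 1)) - y s (dyadicPt n k)‖ₑ},
        ‖y s (dyadicPt n (k + 1)) - y s (dyadicPt n k)‖ₑ ∂P) atTop (𝓝 0) := by
  let A : ℕ → ℕ → Set S := fun n k => {s | R < ‖y s (dyadicPt n (k + 1)) - y s (dyadicPt n k)‖ₑ}
  have hΔ : ∀ n k, Measurable fun s => ‖y s (dyadicPt n (k + 1)) - y s (dyadicPt n k)‖ₑ :=
    fun n k => ((h.measurable_position_at _).sub (h.measurable_position_at _)).enorm
  have hA : ∀ n k, MeasurableSet (A n k) := fun n k => measurableSet_lt measurable_const (hΔ n k)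
  have hw : Measurable fun s => ∫⁻ u, ‖w s u‖ₑ := h.measurable_velocity.enorm.lintegral_prod_right'
  have hlim : Tendsto (fun n => ∫⁻ s, (⋃ k, A n k).indicator (fun s => ∫⁻ u, ‖w s u‖ₑ) s ∂P)
      atTop (𝓝 0) := by
    rw [← lintegral_zero (μ := P)]
    refine tendsto_lintegral_of_dominated_convergence _
      (fun n => hw.indicator (MeasurableSet.iUnion (hA n)))
      (fun n => ae_of_all _ fun s => indicator_le_self _ _ s) h.lintegral_velocity_ne_top
      (ae_of_all _ fun s => tendsto_const_nhds.congr' ?_)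
    filter_upwards [h.eventually_forall_dyadicPt_enorm_le s (ENNReal.coe_pos.2 hR)] with n hn
    refine (indicator_of_notMem ?_ _).symm
    simpa only [A, mem_iUnion, mem_ofPred_eq, not_exists, not_lt] using hn
  exact tendsto_of_tendsto_of_tendsto_of_le_of_le tendsto_const_nhds hlim (fun _ => bot_le)
    fun n => sum_setLIntegral_le_lintegral_indicator_iUnion (hΔ n) (hA n) fun s =>
      h.sum_enorm_dyadicPt_sub_le s n (N n)

end HasVelocity

end Velocity

section ResampledLaw

variable {S : Type*} [MeasurableSpace S] {E : Type*} [NormedAddCommGroup E] [MeasurableSpace E]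
  [BorelSpace E] [SecondCountableTopology E] [CompleteSpace E]

/-- The law of the step process on rational times which follows the process `y` resampled at the
times of the grid `2⁻ⁿ ℕ`: at each of these times it takes a new transition of `y` from its current
position. -/
noncomputable def resampledLaw (P : Measure S) [IsFiniteMeasure P] (y : S → ℝ → E) (n : ℕ) :
    Measure (ℚ → E) :=
  (markovLaw P fun k s => y s (dyadicPt n k)).map fun z q => z ⌊(q : ℝ) * 2 ^ n⌋₊

variable {P : Measure S} [IsProbabilityMeasure P] {y w : S → ℝ → E}

lemma isProbabilityMeasure_resampledLaw (hy : ∀ r, Measurable fun s => y s r) (n : ℕ) :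
    IsProbabilityMeasure (resampledLaw P y n) := by
  have := isProbabilityMeasure_markovLaw (P := P) fun k => hy (dyadicPt n k)
  exact Measure.isProbabilityMeasure_map (Measurable.aemeasurable (by fun_prop))

omit [IsProbabilityMeasure P] in
lemma lintegral_resampledLaw [IsFiniteMeasure P] (n : ℕ) {F : (ℚ → E) → ENNReal}
    (hF : Measurable F) :
    ∫⁻ ω, F ω ∂(resampledLaw P y n) =
      ∫⁻ z, F (fun q => z ⌊(q : ℝ) * 2 ^ n⌋₊) ∂(markovLaw P fun k s => y s (dyadicPt n k)) :=
  lintegral_map hF (by fun_prop)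

lemma map_resampledLaw (hy : ∀ r, Measurable fun s => y s r) (n : ℕ) (q : ℚ) :
    (resampledLaw P y n).map (fun ω => ω q) = P.map fun s => y s (dyadicFloor n q) := by
  rw [resampledLaw, Measure.map_map (by fun_prop) (by fun_prop)]
  exact map_markovLaw (P := P) (fun k => hy (dyadicPt n k)) ⌊(q : ℝ) * 2 ^ n⌋₊

lemma lintegral_comp_resampledLaw (hy : ∀ r, Measurable fun s => y s r) (n : ℕ) (u : ℝ)
    {F : E → ENNReal} (hF : Measurable F) :
    ∫⁻ ω, F (ω (dyadicFloor n u)) ∂(resampledLaw P y n) =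
      ∫⁻ s, F (y s (dyadicFloor n u)) ∂P := by
  rw [← lintegral_map (g := fun ω : ℚ → E => ω (dyadicFloor n u)) hF (by fun_prop),
    map_resampledLaw hy, dyadicFloor_dyadicFloor le_rfl, lintegral_map hF (hy _)]

variable [NormedSpace ℝ E]

lemma lintegral_resampledLaw_sub_le (h : HasVelocity P y w) (n : ℕ) {q r : ℚ} (hqr : q ≤ r) :
    ∫⁻ ω, ‖ω r - ω q‖ₑ ∂(resampledLaw P y n) ≤
      ∫⁻ u in Ico (dyadicFloor n q : ℝ) (dyadicFloor n r), ∫⁻ s, ‖w s u‖ₑ ∂P := by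
  have hle : ⌊(q : ℝ) * 2 ^ n⌋₊ ≤ ⌊(r : ℝ) * 2 ^ n⌋₊ := Nat.floor_mono (by gcongr)
  have hY : ∀ k, Measurable fun s => y s (dyadicPt n k) := fun k => h.measurable_position_at _
  rw [lintegral_resampledLaw n (by fun_prop), dyadicFloor, dyadicFloor,
    ← sum_setLIntegral_Ico (monotone_dyadicPt n) _ hle]
  beta_reduce
  generalize ⌊(q : ℝ) * 2 ^ n⌋₊ = i at hle ⊢
  generalize ⌊(r : ℝ) * 2 ^ n⌋₊ = j at hle ⊢
  calc ∫⁻ z, ‖z j - z i‖ₑ ∂(markovLaw P fun k s => y s (dyadicPt n k))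
      ≤ ∫⁻ z, ∑ k ∈ Finset.Ico i j, ‖z (k + 1) - z k‖ₑ
          ∂(markovLaw P fun k s => y s (dyadicPt n k)) := by
        refine lintegral_mono fun z => ?_
        rw [← Finset.sum_Ico_sub z hle]
        exact enorm_sum_le _ _
    _ = ∑ k ∈ Finset.Ico i j, ∫⁻ s, ‖y s (dyadicPt n (k + 1)) - y s (dyadicPt n k)‖ₑ ∂P := by
        rw [lintegral_finsetSum _ fun k _ => by fun_prop]
        exact Finset.sum_congr rfl fun k _ =>
          lintegral_pair_markovLaw hY k (g := fun p => ‖p.2 - p.1‖ₑ) (by fun_prop)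
    _ ≤ _ := Finset.sum_le_sum fun k _ =>
        h.lintegral_position_sub_le (monotone_dyadicPt n k.le_succ)

end ResampledLaw

section Drift

/-- The failure of `ω` to solve the integral equation of the field `b` at time `q`, when the time
integral is discretized on the grid `2⁻ⁿ ℕ`. -/
noncomputable def driftDefect {E : Type*} [NormedAddCommGroup E] [NormedSpace ℝ E]
    (b : ℝ → E → E) (n : ℕ) (q : ℚ) (ω : ℚ → E) : E :=
  ω q - ω 0 - ∫ u in (0 : ℝ)..q, b (dyadicFloor n u) (ω (dyadicFloor n u))

lemma driftDefect_dyadicPt {E : Type*} [NormedAddCommGroup E] [NormedSpace ℝ E]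
    [CompleteSpace E] (b : ℝ → E → E) (n N : ℕ) (ω : ℚ → E) :
    driftDefect b n (dyadicPt n N) ω = ω (dyadicPt n N) - ω 0 -
      ∑ k ∈ Finset.range N, (1 / 2 : ℝ) ^ n • b (dyadicPt n k) (ω (dyadicPt n k)) :=
  congrArg (_ - ·) (integral_comp_dyadicFloor n (fun q : ℚ => b q (ω q)) N)

lemma tendsto_zero_of_forall_le_add {ι κ : Type*} {l : Filter ι} {l' : Filter κ} [NeBot l']
    {D : ι → ENNReal} {a : κ → ENNReal} {e : κ → ι → ENNReal} (ha : Tendsto a l' (𝓝 0))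
    (he : ∀ᶠ k in l', Tendsto (e k) l (𝓝 0)) (hD : ∀ᶠ k in l', ∀ᶠ i in l, D i ≤ a k + e k i) :
    Tendsto D l (𝓝 0) := by
  refine ENNReal.tendsto_nhds_zero.2 fun ε hε => ?_
  have hε2 : 0 < ε / 2 := ENNReal.half_pos hε.ne'
  obtain ⟨k, hak, hek, hDk⟩ := ((ENNReal.tendsto_nhds_zero.1 ha _ hε2).and (he.and hD)).exists
  filter_upwards [hDk, ENNReal.tendsto_nhds_zero.1 hek _ hε2] with i hi hei
  exact (hi.trans (add_le_add hak hei)).trans_eq (ENNReal.add_halves ε)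

variable {S : Type*} [MeasurableSpace S] {P : Measure S} [IsProbabilityMeasure P] {E : Type*}
  [NormedAddCommGroup E] [MeasurableSpace E] [BorelSpace E] [SecondCountableTopology E]
  [CompleteSpace E] {y w : S → ℝ → E}

lemma lintegral_position_step_sub_le [NormedSpace ℝ E] (h : HasVelocity P y w) (n k : ℕ) :
    ∫⁻ s, ‖y s (dyadicPt n (k + 1)) - y s (dyadicPt n k) -
        (1 / 2 : ℝ) ^ n • w s (dyadicPt n k)‖ₑ ∂P ≤
      ∫⁻ u in Ico (dyadicPt n k : ℝ) (dyadicPt n (k + 1)),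
        ∫⁻ s, ‖w s (dyadicFloor n u) - w s u‖ₑ ∂P := by
  have hle : (dyadicPt n k : ℝ) ≤ dyadicPt n (k + 1) := monotone_dyadicPt n k.le_succ
  have hstep : ∀ s, y s (dyadicPt n (k + 1)) - y s (dyadicPt n k) -
      (1 / 2 : ℝ) ^ n • w s (dyadicPt n k) =
      ∫ u in Ico (dyadicPt n k : ℝ) (dyadicPt n (k + 1)), (w s u - w s (dyadicPt n k)) := by
    intro s
    rw [integral_sub (h.integrable_velocity s).integrableOn (integrableOn_const (by simp)),
      setIntegral_const, measureReal_def, Real.volume_Ico, dyadicPt_succ_sub,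
      ENNReal.toReal_ofReal (by positivity), h.integral_velocity,
      intervalIntegral.integral_of_le hle, integral_Ico_eq_integral_Ioc]
  calc ∫⁻ s, ‖y s (dyadicPt n (k + 1)) - y s (dyadicPt n k) -
          (1 / 2 : ℝ) ^ n • w s (dyadicPt n k)‖ₑ ∂P
      ≤ ∫⁻ s, (∫⁻ u in Ico (dyadicPt n k : ℝ) (dyadicPt n (k + 1)),
          ‖w s (dyadicFloor n u) - w s u‖ₑ) ∂P := by
        refine lintegral_mono fun s => ?_
        rw [hstep s]
        refine (enorm_integral_le_lintegral_enorm _).trans_eq ?_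
        refine setLIntegral_congr_fun measurableSet_Ico fun u hu => ?_
        simp only [dyadicFloor_of_mem_Ico hu, enorm_sub_rev]
    _ = _ := lintegral_lintegral_swap (Measurable.aemeasurable
        ((h.measurable_velocity.comp (f := fun p : S × ℝ => (p.1, (dyadicFloor n p.2 : ℝ)))
          (by fun_prop)).sub h.measurable_velocity).enorm)

variable [InnerProductSpace ℝ E] {b : ℝ → E → E}

/-- Here the resampled process follows the field sampled on the grid; the three error terms are
the martingale part, its large increments, and the time discretization of the velocity. -/
lemma lintegral_resampledLaw_drift_le (h : HasVelocity P y w) (hb : ∀ r, Measurable (b r))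
    {n : ℕ} (hmean : ∀ k, HasMeanVelocityAt P y w b (dyadicPt n k)) (R : NNReal) (N : ℕ) :
    ∫⁻ ω, ‖driftDefect b n (dyadicPt n N) ω‖ₑ ∂(resampledLaw P y n) ≤
      2 * (R * ∫⁻ u, ∫⁻ s, ‖w s u‖ₑ ∂P) ^ (1 / 2 : ℝ) +
      2 * ∑ k ∈ Finset.range N,
        ∫⁻ s in {s | R < ‖y s (dyadicPt n (k + 1)) - y s (dyadicPt n k)‖ₑ},
          ‖y s (dyadicPt n (k + 1)) - y s (dyadicPt n k)‖ₑ ∂P +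
      ∫⁻ u in Ico 0 (dyadicPt n N : ℝ), ∫⁻ s, ‖w s (dyadicFloor n u) - w s u‖ₑ ∂P := by
  have hzero : (dyadicPt n 0 : ℝ) = 0 := by rw [dyadicPt_zero_right, Rat.cast_zero]
  have hle : ∀ k, (dyadicPt n k : ℝ) ≤ dyadicPt n (k + 1) := fun k =>
    monotone_dyadicPt n k.le_succ
  have hcm : ∀ k, Measurable fun x => (1 / 2 : ℝ) ^ n • b (dyadicPt n k) x := fun k =>
    (hb (dyadicPt n k)).const_smul _
  simp only [driftDefect_dyadicPt]
  rw [lintegral_resampledLaw n (by fun_prop)]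
  simp only [floor_dyadicPt, Rat.cast_zero, zero_mul, Nat.floor_zero]
  have hchain := lintegral_enorm_markovLaw_sub_sum_le (P := P)
    (Y := fun k s => y s (dyadicPt n k)) (fun k => h.measurable_position_at (dyadicPt n k))
    (fun k => h.integrable_position_sub (hle k))
    (V := fun k s => (1 / 2 : ℝ) ^ n • w s (dyadicPt n k)) (fun k => (hmean k).integrable.smul _)
    (c := fun k x => (1 / 2 : ℝ) ^ n • b (dyadicPt n k) x) hcm
    (fun k => ((condExp_smul _ _ _).trans
      ((hmean k).condExp_ae_eq.const_smul _))) R N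
  refine hchain.trans ?_
  gcongr
  · refine (Finset.sum_le_sum fun k _ => h.lintegral_position_sub_le (hle k)).trans ?_
    rw [Finset.range_eq_Ico, sum_setLIntegral_Ico (monotone_dyadicPt n) _ N.zero_le]
    exact setLIntegral_le_lintegral _ _
  · refine (Finset.sum_le_sum fun k _ => lintegral_position_step_sub_le h n k).trans_eq ?_
    rw [Finset.range_eq_Ico, sum_setLIntegral_Ico (monotone_dyadicPt n) _ N.zero_le, hzero]

lemma tendsto_lintegral_resampledLaw_drift (h : HasVelocity P y w)
    (hb : ∀ r, Measurable (b r)) (hmean : ∀ q : ℚ, HasMeanVelocityAt P y w b q) {φ : ℕ → ℕ}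
    (hφ : Tendsto φ atTop atTop) {T : ℝ}
    (hw : Tendsto (fun n => ∫⁻ u in Icc 0 T, ∫⁻ s, ‖w s (dyadicFloor (φ n) u) - w s u‖ₑ ∂P)
      atTop (𝓝 0)) {l j : ℕ} (hT : dyadicPt l j ≤ T) :
    Tendsto (fun n => ∫⁻ ω, ‖driftDefect b (φ n) (dyadicPt l j) ω‖ₑ ∂(resampledLaw P y (φ n)))
      atTop (𝓝 0) := by
  let N : ℕ → ℕ := fun n => ⌊(dyadicPt l j : ℝ) * 2 ^ n⌋₊
  let large : NNReal → ℕ → ENNReal := fun R n => ∑ k ∈ Finset.range (N n),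
    ∫⁻ s in {s | R < ‖y s (dyadicPt n (k + 1)) - y s (dyadicPt n k)‖ₑ},
      ‖y s (dyadicPt n (k + 1)) - y s (dyadicPt n k)‖ₑ ∂P
  have hmart : Tendsto (fun R : NNReal =>
      2 * ((R : ENNReal) * ∫⁻ u, ∫⁻ s, ‖w s u‖ₑ ∂P) ^ (1 / 2 : ℝ)) (𝓝[>] 0) (𝓝 0) := by
    have hcont := (ENNReal.continuous_const_mul (a := 2) (by simp)).comp
      ((ENNReal.continuous_rpow_const (y := 1 / 2)).comp
        ((ENNReal.continuous_mul_const h.lintegral_lintegral_velocity_ne_top).comp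
          ENNReal.continuous_coe))
    simpa [Function.comp_def] using (hcont.tendsto 0).mono_left nhdsWithin_le_nhds
  refine tendsto_zero_of_forall_le_add hmart
    (e := fun R n => 2 * large R (φ n) +
      ∫⁻ u in Icc 0 T, ∫⁻ s, ‖w s (dyadicFloor (φ n) u) - w s u‖ₑ ∂P) ?_ ?_
  · filter_upwards [self_mem_nhdsWithin] with R hR
    have hlarge : Tendsto (fun n => large R (φ n)) atTop (𝓝 0) :=
      (h.tendsto_sum_setLIntegral_large_increments hR N).comp hφ
    simpa using (ENNReal.Tendsto.const_mul hlarge (Or.inr (by simp))).add hw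
  · refine Eventually.of_forall fun R => (hφ.eventually_ge_atTop l).mono fun n hn => ?_
    have hN : dyadicPt (φ n) (N (φ n)) = dyadicPt l j := dyadicFloor_dyadicPt hn j
    refine (hN ▸ lintegral_resampledLaw_drift_le h hb (fun k => hmean _) R (N (φ n))).trans ?_
    rw [← add_assoc]
    gcongr
    exact (Ico_subset_Icc_self).trans (Icc_subset_Icc le_rfl hT)

end Drift

section LipschitzComparison

variable {E : Type*} [NormedAddCommGroup E]

lemma lintegral_lipschitz_comp_sub_le {Ω F : Type*} [MeasurableSpace Ω] {μ : Measure Ω}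
    [IsProbabilityMeasure μ] [NormedAddCommGroup F] {c : ℝ → E → F} {K : NNReal}
    (hc : LipschitzWith K fun p : ℝ × E => c p.1 p.2) {α : ℝ → ENNReal} (hα : Measurable α)
    {m : ℕ} {T : ℝ} {τ τ' : ℝ → ℝ} {X X' : ℝ → Ω → E}
    (hτ : ∀ u ∈ Icc 0 T, |τ u - τ' u| ≤ (1 / 2) ^ m)
    (hX : ∀ u ∈ Icc 0 T,
      ∫⁻ ω, ‖X u ω - X' u ω‖ₑ ∂μ ≤ ∫⁻ v in Ico (dyadicFloor m u : ℝ) u, α v) :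
    ∫⁻ u in Icc 0 T, ∫⁻ ω, ‖c (τ u) (X u ω) - c (τ' u) (X' u ω)‖ₑ ∂μ ≤
      K * (ENNReal.ofReal ((1 / 2) ^ m) * (ENNReal.ofReal T + ∫⁻ v, α v)) := by
  have hpt : ∀ u ∈ Icc 0 T, ∫⁻ ω, ‖c (τ u) (X u ω) - c (τ' u) (X' u ω)‖ₑ ∂μ ≤
      K * (ENNReal.ofReal ((1 / 2) ^ m) + ∫⁻ v in Ico (dyadicFloor m u : ℝ) u, α v) := by
    intro u hu
    calc ∫⁻ ω, ‖c (τ u) (X u ω) - c (τ' u) (X' u ω)‖ₑ ∂μ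
        ≤ ∫⁻ ω, K * (ENNReal.ofReal ((1 / 2) ^ m) + ‖X u ω - X' u ω‖ₑ) ∂μ := by
          refine lintegral_mono fun ω => ?_
          rw [← edist_eq_enorm_sub, ← edist_eq_enorm_sub]
          refine (hc (τ u, X u ω) (τ' u, X' u ω)).trans ?_
          gcongr
          rw [Prod.edist_eq, max_le_iff]
          refine ⟨le_add_right ?_, le_add_self⟩
          rw [edist_dist, Real.dist_eq]
          exact ENNReal.ofReal_le_ofReal (hτ u hu)
      _ = K * (ENNReal.ofReal ((1 / 2) ^ m) + ∫⁻ ω, ‖X u ω - X' u ω‖ₑ ∂μ) := by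
          rw [lintegral_const_mul' _ _ ENNReal.coe_ne_top, lintegral_add_left measurable_const,
            lintegral_const, measure_univ, mul_one]
      _ ≤ _ := by gcongr; exact hX u hu
  refine (setLIntegral_mono' measurableSet_Icc hpt).trans ?_
  rw [lintegral_const_mul' _ _ ENNReal.coe_ne_top, lintegral_add_left measurable_const,
    setLIntegral_const, Real.volume_Icc, sub_zero, mul_add (ENNReal.ofReal ((1 / 2) ^ m))]
  gcongr
  exact lintegral_lintegral_Ico_dyadicFloor_le hα m T

section Defect

variable [NormedSpace ℝ E] {b c : ℝ → E → E}

lemma enorm_driftDefect_sub_le {m n l j : ℕ} (hlm : l ≤ m) (hln : l ≤ n) {T : ℝ}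
    (hT : dyadicPt l j ≤ T) (ω : ℚ → E) :
    ‖driftDefect c m (dyadicPt l j) ω - driftDefect b n (dyadicPt l j) ω‖ₑ ≤
      ∫⁻ u in Icc 0 T, ‖b (dyadicFloor n u) (ω (dyadicFloor n u)) -
        c (dyadicFloor m u) (ω (dyadicFloor m u))‖ₑ := by
  obtain ⟨M, hM⟩ := exists_dyadicPt_eq hlm j
  obtain ⟨N, hN⟩ := exists_dyadicPt_eq hln j
  have hc := intervalIntegrable_comp_dyadicFloor m (fun q : ℚ => c q (ω q)) M
  have hb := intervalIntegrable_comp_dyadicFloor n (fun q : ℚ => b q (ω q)) N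
  rw [hM] at hc
  rw [hN] at hb
  have hzero : (0 : ℝ) ≤ dyadicPt l j := by rw [coe_dyadicPt]; positivity
  rw [driftDefect, driftDefect, sub_sub_sub_cancel_left, ← intervalIntegral.integral_sub hb hc,
    intervalIntegral.integral_of_le hzero]
  exact (enorm_integral_le_lintegral_enorm _).trans
    (lintegral_mono_set (Ioc_subset_Icc_self.trans (Icc_subset_Icc le_rfl hT)))

lemma measurable_field_comp_dyadicFloor {F : Type*} [MeasurableSpace F] {b : ℝ → F → F}
    (hb : ∀ r, Measurable (b r)) (n : ℕ) :
    Measurable fun p : (ℚ → F) × ℝ => b (dyadicFloor n p.2) (p.1 (dyadicFloor n p.2)) :=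
  (measurable_from_prod_countable_left (f := fun p : (ℚ → F) × ℚ => b p.2 (p.1 p.2))
    fun q => (hb q).comp (measurable_pi_apply q)).comp
    (measurable_fst.prodMk ((measurable_dyadicFloor n).comp measurable_snd))

variable [MeasurableSpace E] [BorelSpace E] [SecondCountableTopology E]

lemma measurable_driftDefect [CompleteSpace E] (hb : ∀ r, Measurable (b r)) {l n : ℕ}
    (hln : l ≤ n) (j : ℕ) : Measurable (driftDefect b n (dyadicPt l j)) := by
  obtain ⟨N, hN⟩ := exists_dyadicPt_eq hln j
  rw [← hN, funext (driftDefect_dyadicPt b n N)]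
  fun_prop

lemma lintegral_driftDefect_le_add [CompleteSpace E] {Q : Measure (ℚ → E)} [SFinite Q]
    (hb : ∀ r, Measurable (b r)) (hc : ∀ r, Measurable (c r)) {m n l j : ℕ} (hlm : l ≤ m)
    (hln : l ≤ n) {T : ℝ} (hT : dyadicPt l j ≤ T) :
    ∫⁻ ω, ‖driftDefect c m (dyadicPt l j) ω‖ₑ ∂Q ≤
      ∫⁻ ω, ‖driftDefect b n (dyadicPt l j) ω‖ₑ ∂Q +
        ∫⁻ u in Icc 0 T, ∫⁻ ω, ‖b (dyadicFloor n u) (ω (dyadicFloor n u)) -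
          c (dyadicFloor m u) (ω (dyadicFloor m u))‖ₑ ∂Q := by
  rw [← lintegral_lintegral_swap ((measurable_field_comp_dyadicFloor hb n).sub
    (measurable_field_comp_dyadicFloor hc m)).enorm.aemeasurable,
    ← lintegral_add_left (measurable_driftDefect hb hln j).enorm]
  refine lintegral_mono fun ω => le_trans ?_ (add_le_add_right
    (enorm_driftDefect_sub_le hlm hln hT ω) _)
  simpa using enorm_add_le (driftDefect b n (dyadicPt l j) ω)
    (driftDefect c m (dyadicPt l j) ω - driftDefect b n (dyadicPt l j) ω)

lemma lintegral_lintegral_enorm_sub_le_add {α Ω F : Type*} [MeasurableSpace α]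
    [MeasurableSpace Ω] [NormedAddCommGroup F] [MeasurableSpace F] [BorelSpace F]
    [SecondCountableTopology F] {ν : Measure α} {μ : Measure Ω} [SFinite μ] {f g k : α → Ω → F}
    (hf : Measurable fun p : Ω × α => f p.2 p.1) (hg : Measurable fun p : Ω × α => g p.2 p.1) :
    ∫⁻ u, ∫⁻ ω, ‖f u ω - k u ω‖ₑ ∂μ ∂ν ≤
      ∫⁻ u, ∫⁻ ω, ‖f u ω - g u ω‖ₑ ∂μ ∂ν + ∫⁻ u, ∫⁻ ω, ‖g u ω - k u ω‖ₑ ∂μ ∂ν := by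
  have hfg : Measurable fun p : Ω × α => ‖f p.2 p.1 - g p.2 p.1‖ₑ := (hf.sub hg).enorm
  have hfg_at : ∀ u, Measurable fun ω => ‖f u ω - g u ω‖ₑ := fun u =>
    hfg.comp (by fun_prop : Measurable fun ω : Ω => (ω, u))
  rw [← lintegral_add_left hfg.lintegral_prod_left']
  refine lintegral_mono fun u => ?_
  rw [← lintegral_add_left (hfg_at u)]
  exact lintegral_mono fun ω => by
    simpa using enorm_add_le (f u ω - g u ω) (g u ω - k u ω)

variable {S : Type*} [MeasurableSpace S] {P : Measure S} [IsProbabilityMeasure P]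
  [CompleteSpace E] {y w : S → ℝ → E}

lemma lintegral_resampledLaw_lipschitz_comp_sub_le (h : HasVelocity P y w) {K : NNReal}
    (hc : LipschitzWith K fun p : ℝ × E => c p.1 p.2) {m n : ℕ} (hmn : m ≤ n) (T : ℝ) :
    ∫⁻ u in Icc 0 T, ∫⁻ ω, ‖c (dyadicFloor n u) (ω (dyadicFloor n u)) -
        c (dyadicFloor m u) (ω (dyadicFloor m u))‖ₑ ∂(resampledLaw P y n) ≤
      K * (ENNReal.ofReal ((1 / 2) ^ m) *
        (ENNReal.ofReal T + ∫⁻ v, ∫⁻ s, ‖w s v‖ₑ ∂P)) := by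
  have := isProbabilityMeasure_resampledLaw (P := P) (fun r => h.measurable_position_at r) n
  have hmono : ∀ u ∈ Icc 0 T, (dyadicFloor m u : ℝ) ≤ dyadicFloor n u := fun u hu =>
    monotone_dyadicFloor_left hu.1 hmn
  refine lintegral_lipschitz_comp_sub_le hc h.measurable_lintegral_velocity
    (X := fun u (ω : ℚ → E) => ω (dyadicFloor n u)) (X' := fun u ω => ω (dyadicFloor m u))
    (fun u hu => ?_) (fun u hu => ?_)
  · rw [abs_of_nonneg (sub_nonneg.2 (hmono u hu))]
    linarith [dyadicFloor_le n hu.1, lt_dyadicFloor_add m u]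
  · refine (lintegral_resampledLaw_sub_le h n (Rat.cast_le.1 (hmono u hu))).trans ?_
    rw [dyadicFloor_dyadicFloor le_rfl, dyadicFloor_dyadicFloor hmn]
    exact lintegral_mono_set (Ico_subset_Ico_right (dyadicFloor_le n hu.1))

lemma lintegral_resampledLaw_driftDefect_lipschitz_le (h : HasVelocity P y w)
    (hb : ∀ r, Measurable (b r)) {K : NNReal} (hc : LipschitzWith K fun p : ℝ × E => c p.1 p.2)
    {l m n j : ℕ} (hlm : l ≤ m) (hmn : m ≤ n) {T : ℝ} (hT : dyadicPt l j ≤ T) :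
    ∫⁻ ω, ‖driftDefect c m (dyadicPt l j) ω‖ₑ ∂(resampledLaw P y n) ≤
      ∫⁻ ω, ‖driftDefect b n (dyadicPt l j) ω‖ₑ ∂(resampledLaw P y n) +
      (∫⁻ u in Icc 0 T, ∫⁻ s, ‖b (dyadicFloor n u) (y s (dyadicFloor n u)) -
        c (dyadicFloor n u) (y s (dyadicFloor n u))‖ₑ ∂P) +
      K * (ENNReal.ofReal ((1 / 2) ^ m) *
        (ENNReal.ofReal T + ∫⁻ v, ∫⁻ s, ‖w s v‖ₑ ∂P)) := by
  have hy : ∀ r, Measurable fun s => y s r := fun r => h.measurable_position_at r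
  have := isProbabilityMeasure_resampledLaw (P := P) hy n
  have hcm : ∀ r, Measurable (c r) := fun r =>
    (hc.continuous.comp (by fun_prop : Continuous fun x : E => (r, x))).measurable
  refine (lintegral_driftDefect_le_add hb hcm hlm (hlm.trans hmn) hT).trans ?_
  rw [add_assoc]
  gcongr
  refine (lintegral_lintegral_enorm_sub_le_add
    (g := fun u ω => c (dyadicFloor n u) (ω (dyadicFloor n u))) 
    (measurable_field_comp_dyadicFloor hb n)
    (measurable_field_comp_dyadicFloor hcm n)).trans ?_
  gcongr with u
  · exact (lintegral_comp_resampledLaw hy n u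
      (F := fun x => ‖b (dyadicFloor n u) x - c (dyadicFloor n u) x‖ₑ) (by fun_prop)).le
  · exact lintegral_resampledLaw_lipschitz_comp_sub_le h hc hmn T

end Defect

end LipschitzComparison

section LimitLaw

lemma exists_isCompact_forall_measure_pi_compl_le {ι E : Type*} [Countable ι] [TopologicalSpace E]
    [T2Space E] [MeasurableSpace E] [BorelSpace E] {κ : Type*} {Q : κ → Measure (ι → E)}
    (h : ∀ i, IsTightMeasureSet (range fun n => (Q n).map fun z => z i)) {ε : ENNReal}
    (hε : 0 < ε) : ∃ K : Set (ι → E), IsCompact K ∧ ∀ n, Q n Kᶜ ≤ ε := by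
  obtain ⟨ε', hε', hsum⟩ := ENNReal.exists_pos_sum_of_countable' hε.ne' ι
  choose K hK hKε using fun i =>
    isTightMeasureSet_iff_exists_isCompact_measure_compl_le.1 (h i) (ε' i) (hε' i)
  refine ⟨univ.pi K, isCompact_univ_pi hK, fun n => ?_⟩
  have hsub : (univ.pi K)ᶜ ⊆ ⋃ i, (fun z : ι → E => z i) ⁻¹' (K i)ᶜ := fun z hz => by
    simpa [Set.mem_pi] using hz
  refine (measure_mono hsub).trans ((measure_iUnion_le _).trans (le_trans ?_ hsum.le))
  refine ENNReal.tsum_le_tsum fun i => ?_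
  rw [← Measure.map_apply (measurable_pi_apply i) (hK i).measurableSet.compl]
  exact hKε i _ ⟨n, rfl⟩

lemma exists_subseq_tendsto_of_tight_marginals {ι E : Type*} [Countable ι] [TopologicalSpace E]
    [PolishSpace E] [MeasurableSpace E] [BorelSpace E] (Q : ℕ → ProbabilityMeasure (ι → E))
    (h : ∀ i, IsTightMeasureSet (range fun n => (Q n : Measure (ι → E)).map fun z => z i)) :
    ∃ (Q' : ProbabilityMeasure (ι → E)) (φ : ℕ → ℕ), StrictMono φ ∧
      Tendsto (fun n => Q (φ n)) atTop (𝓝 Q') := by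
  have htight : IsTightMeasureSet {((μ : ProbabilityMeasure (ι → E)) : Measure (ι → E)) |
      μ ∈ range Q} := by
    rw [isTightMeasureSet_iff_exists_isCompact_measure_compl_le]
    intro ε hε
    obtain ⟨K, hK, hKε⟩ := exists_isCompact_forall_measure_pi_compl_le h hε
    refine ⟨K, hK, ?_⟩
    rintro _ ⟨_, ⟨n, rfl⟩, rfl⟩
    exact hKε n
  obtain ⟨Q', -, φ, hφ, hlim⟩ := (isCompact_closure_of_isTightMeasureSet htight).isSeqCompact
    (x := Q) (fun n => subset_closure ⟨n, rfl⟩)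
  exact ⟨Q', φ, hφ, hlim⟩

lemma lintegral_enorm_le_of_tendsto {Ω F : Type*} [TopologicalSpace Ω] [MeasurableSpace Ω]
    [OpensMeasurableSpace Ω] [HasOuterApproxClosed Ω] [NormedAddCommGroup F]
    {Q : ℕ → ProbabilityMeasure Ω} {Q' : ProbabilityMeasure Ω} (hQ : Tendsto Q atTop (𝓝 Q'))
    {g : Ω → F} (hg : Continuous g) {B : ℕ → ENNReal} {B' : ENNReal}
    (hB : ∀ᶠ n in atTop, ∫⁻ ω, ‖g ω‖ₑ ∂(Q n : Measure Ω) ≤ B n) (hB' : Tendsto B atTop (𝓝 B')) :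
    ∫⁻ ω, ‖g ω‖ₑ ∂(Q' : Measure Ω) ≤ B' := by
  have h := lintegral_le_liminf_lintegral_of_forall_isOpen_measure_le_liminf_measure
    (μ := (Q' : Measure Ω)) (μs := fun n => (Q n : Measure Ω)) (f := fun ω => ‖g ω‖) hg.norm
    (fun _ => norm_nonneg _)
    (fun G hG => ProbabilityMeasure.le_liminf_measure_open_of_tendsto hQ hG)
  simp only [ofReal_norm] at h
  exact h.trans ((liminf_le_liminf hB).trans_eq hB'.liminf_eq)

lemma isTightMeasureSet_range_map_of_norm_le {S E ι : Type*} [MeasurableSpace S] (P : Measure S)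
    [IsFiniteMeasure P] [NormedAddCommGroup E] [MeasurableSpace E] [BorelSpace E] [ProperSpace E]
    {Y : ι → S → E} (hY : ∀ i, Measurable (Y i)) {R : S → ℝ} (hR : Measurable R)
    (h : ∀ i s, ‖Y i s‖ ≤ R s) : IsTightMeasureSet (range fun i => P.map (Y i)) := by
  refine isTightMeasureSet_of_tendsto_measure_norm_gt
    (tendsto_of_tendsto_of_tendsto_of_le_of_le tendsto_const_nhds
      (tendsto_measure_norm_gt_of_isTightMeasureSet
        (isTightMeasureSet_singleton (μ := P.map R)))
      (fun _ => bot_le) fun r => iSup₂_le ?_)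
  rintro _ ⟨i, rfl⟩
  rw [iSup_singleton, Measure.map_apply (hY i) (measurableSet_lt measurable_const (by fun_prop)),
    Measure.map_apply hR (measurableSet_lt measurable_const (by fun_prop))]
  exact measure_mono fun s hs => hs.trans_le ((h i s).trans (le_abs_self _))

variable {S : Type*} [MeasurableSpace S] {E : Type*} [NormedAddCommGroup E] [NormedSpace ℝ E]
  [MeasurableSpace E]

/-- A law on the paths over rational times which has at dyadic times the one-dimensional marginals
of `y` and increments dominated in mean by the velocity `w`, and whose defect for a Lipschitz field
`c` is controlled, up to time `T`, by the distance from `c` to the field `b` along `y`. The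
integral equation of `b` itself cannot be imposed, as `b` is only measurable and the paths of the
law are not defined at almost all times. -/
structure IsSuperpositionLaw (P : Measure S) (y w : S → ℝ → E) (b : ℝ → E → E) (T : ℝ)
    (Q : Measure (ℚ → E)) : Prop where
  map_eval : ∀ n k, Q.map (fun ω => ω (dyadicPt n k)) = P.map fun s => y s (dyadicPt n k)
  lintegral_sub_le : ∀ n i j, i ≤ j → ∫⁻ ω, ‖ω (dyadicPt n j) - ω (dyadicPt n i)‖ₑ ∂Q ≤
    ∫⁻ u in Ico (dyadicPt n i : ℝ) (dyadicPt n j), ∫⁻ s, ‖w s u‖ₑ ∂P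
  lintegral_driftDefect_le : ∀ (K : NNReal) (c : ℝ → E → E),
    (LipschitzWith K fun p : ℝ × E => c p.1 p.2) → ∀ l m j, l ≤ m → dyadicPt l j ≤ T →
    ∫⁻ ω, ‖driftDefect c m (dyadicPt l j) ω‖ₑ ∂Q ≤
      (∫⁻ u in Icc 0 T, ∫⁻ s, ‖b u (y s u) - c u (y s u)‖ₑ ∂P) +
      2 * (K * (ENNReal.ofReal ((1 / 2) ^ m) *
        (ENNReal.ofReal T + ∫⁻ u, ∫⁻ s, ‖w s u‖ₑ ∂P)))

variable [BorelSpace E] {P : Measure S} [IsProbabilityMeasure P] {y w : S → ℝ → E}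
  {b c : ℝ → E → E}

lemma lintegral_lipschitz_comp_position_sub_le (h : HasVelocity P y w) {K : NNReal}
    (hc : LipschitzWith K fun p : ℝ × E => c p.1 p.2) (n : ℕ) (T : ℝ) :
    ∫⁻ u in Icc 0 T, ∫⁻ s, ‖c u (y s u) - c (dyadicFloor n u) (y s (dyadicFloor n u))‖ₑ ∂P ≤
      K * (ENNReal.ofReal ((1 / 2) ^ n) *
        (ENNReal.ofReal T + ∫⁻ v, ∫⁻ s, ‖w s v‖ₑ ∂P)) := by
  refine lintegral_lipschitz_comp_sub_le hc h.measurable_lintegral_velocity (τ := fun u => u)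
    (X := fun u s => y s u) (X' := fun u s => y s (dyadicFloor n u)) (fun u hu => ?_) (fun u hu =>
      h.lintegral_position_sub_le (dyadicFloor_le n hu.1))
  rw [abs_sub_comm]
  exact abs_dyadicFloor_sub_le n hu.1

lemma lintegral_field_sub_comp_dyadicFloor_le [SecondCountableTopology E]
    (h : HasVelocity P y w)
    (hb : Measurable fun p : ℝ × E => b p.1 p.2) {K : NNReal}
    (hc : LipschitzWith K fun p : ℝ × E => c p.1 p.2) (n : ℕ) (T : ℝ) :
    ∫⁻ u in Icc 0 T, ∫⁻ s, ‖b (dyadicFloor n u) (y s (dyadicFloor n u)) -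
        c (dyadicFloor n u) (y s (dyadicFloor n u))‖ₑ ∂P ≤
      (∫⁻ u in Icc 0 T, ∫⁻ s,
        ‖b (dyadicFloor n u) (y s (dyadicFloor n u)) - b u (y s u)‖ₑ ∂P) +
      ((∫⁻ u in Icc 0 T, ∫⁻ s, ‖b u (y s u) - c u (y s u)‖ₑ ∂P) +
      K * (ENNReal.ofReal ((1 / 2) ^ n) *
        (ENNReal.ofReal T + ∫⁻ v, ∫⁻ s, ‖w s v‖ₑ ∂P))) := by
  have hc' : Measurable fun p : ℝ × E => c p.1 p.2 := hc.continuous.measurable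
  have hy : Measurable fun p : S × ℝ => (p.2, y p.1 p.2) :=
    measurable_snd.prodMk h.measurable_position
  have hyn : Measurable fun p : S × ℝ => ((dyadicFloor n p.2 : ℝ), y p.1 (dyadicFloor n p.2)) :=
    hy.comp (f := fun p : S × ℝ => (p.1, (dyadicFloor n p.2 : ℝ))) (by fun_prop)
  refine (lintegral_lintegral_enorm_sub_le_add (g := fun u s => b u (y s u))
    (hb.comp hyn) (hb.comp hy)).trans ?_
  gcongr
  refine (lintegral_lintegral_enorm_sub_le_add (g := fun u s => c u (y s u))
    (hb.comp hy) (hc'.comp hy)).trans ?_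
  gcongr
  exact lintegral_lipschitz_comp_position_sub_le h hc n T

variable [ProperSpace E]

lemma isTightMeasureSet_range_map_resampledLaw (h : HasVelocity P y w) (φ : ℕ → ℕ)
    (q : ℚ) : IsTightMeasureSet (range fun n => (resampledLaw P y (φ n)).map fun ω => ω q) := by
  have hy : ∀ r, Measurable fun s => y s r := fun r => h.measurable_position_at r
  simp only [map_resampledLaw hy]
  refine isTightMeasureSet_range_map_of_norm_le P (fun n => hy _)
    (R := fun s => ‖y s 0‖ + (∫⁻ u, ‖w s u‖ₑ).toReal)
    ((hy 0).norm.add h.measurable_velocity.enorm.lintegral_prod_right'.ennreal_toReal)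
    fun n s => ?_
  have hsub : ‖y s (dyadicFloor (φ n) q) - y s 0‖ₑ ≤ ∫⁻ u, ‖w s u‖ₑ :=
    (h.enorm_position_sub_le s (dyadicFloor_nonneg _ _)).trans (setLIntegral_le_lintegral _ _)
  have hsub' := ENNReal.toReal_mono (h.integrable_velocity s).2.ne hsub
  rw [toReal_enorm] at hsub'
  linarith [norm_le_norm_add_norm_sub' (y s (dyadicFloor (φ n) q)) (y s 0)]

omit [NormedSpace ℝ E] in
lemma map_eval_of_tendsto_resampledLaw (hy : ∀ r, Measurable fun s => y s r) {φ : ℕ → ℕ}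
    (hφ : Tendsto φ atTop atTop) {Q : ℕ → ProbabilityMeasure (ℚ → E)}
    (hQ : ∀ n, (Q n : Measure (ℚ → E)) = resampledLaw P y (φ n))
    {Q' : ProbabilityMeasure (ℚ → E)} (hlim : Tendsto Q atTop (𝓝 Q')) (l j : ℕ) :
    (Q' : Measure (ℚ → E)).map (fun ω => ω (dyadicPt l j)) =
      P.map fun s => y s (dyadicPt l j) := by
  let ν : ProbabilityMeasure E :=
    ⟨P.map fun s => y s (dyadicPt l j), Measure.isProbabilityMeasure_map (hy _).aemeasurable⟩
  have hmap := ProbabilityMeasure.tendsto_map_of_tendsto_of_continuous Q Q' hlim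
    (continuous_apply (dyadicPt l j))
  have hconst : ∀ᶠ n in atTop, (Q n).map (continuous_apply (dyadicPt l j)).aemeasurable = ν := by
    filter_upwards [hφ.eventually_ge_atTop l] with n hn
    apply Subtype.ext
    change (Q n : Measure (ℚ → E)).map (fun ω => ω (dyadicPt l j)) = _
    rw [hQ, map_resampledLaw hy, dyadicFloor_dyadicPt hn]
  have heq := tendsto_nhds_unique hmap
    (tendsto_const_nhds.congr' (hconst.mono fun _ h => h.symm))
  exact congrArg (fun μ : ProbabilityMeasure E => (μ : Measure E)) heq

omit [MeasurableSpace E] [BorelSpace E] in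
lemma continuous_driftDefect {c : ℝ → E → E} (hc : ∀ r, Continuous (c r)) {l m : ℕ}
    (hlm : l ≤ m) (j : ℕ) : Continuous (driftDefect c m (dyadicPt l j)) := by
  obtain ⟨M, hM⟩ := exists_dyadicPt_eq hlm j
  rw [← hM, funext (driftDefect_dyadicPt c m M)]
  fun_prop

lemma lintegral_resampledLaw_driftDefect_le_add (h : HasVelocity P y w)
    (hb : Measurable fun p : ℝ × E => b p.1 p.2) {K : NNReal}
    (hc : LipschitzWith K fun p : ℝ × E => c p.1 p.2) {l m n j : ℕ} (hlm : l ≤ m) (hmn : m ≤ n)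
    {T : ℝ} (hT : dyadicPt l j ≤ T) :
    ∫⁻ ω, ‖driftDefect c m (dyadicPt l j) ω‖ₑ ∂(resampledLaw P y n) ≤
      ∫⁻ ω, ‖driftDefect b n (dyadicPt l j) ω‖ₑ ∂(resampledLaw P y n) +
      (∫⁻ u in Icc 0 T, ∫⁻ s,
        ‖b (dyadicFloor n u) (y s (dyadicFloor n u)) - b u (y s u)‖ₑ ∂P) +
      ((∫⁻ u in Icc 0 T, ∫⁻ s, ‖b u (y s u) - c u (y s u)‖ₑ ∂P) +
      2 * (K * (ENNReal.ofReal ((1 / 2) ^ m) *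
        (ENNReal.ofReal T + ∫⁻ u, ∫⁻ s, ‖w s u‖ₑ ∂P)))) := by
  have hpow : (1 / 2 : ℝ) ^ n ≤ (1 / 2) ^ m :=
    pow_le_pow_of_le_one (by norm_num) (by norm_num) hmn
  have hmesh : K * (ENNReal.ofReal ((1 / 2) ^ n) *
      (ENNReal.ofReal T + ∫⁻ v, ∫⁻ s, ‖w s v‖ₑ ∂P)) ≤ K * (ENNReal.ofReal ((1 / 2) ^ m) *
      (ENNReal.ofReal T + ∫⁻ v, ∫⁻ s, ‖w s v‖ₑ ∂P)) := by gcongr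
  have hfield := (lintegral_field_sub_comp_dyadicFloor_le h hb hc n T).trans
    (add_le_add_right (add_le_add_right hmesh _) _)
  calc ∫⁻ ω, ‖driftDefect c m (dyadicPt l j) ω‖ₑ ∂(resampledLaw P y n)
      ≤ _ := lintegral_resampledLaw_driftDefect_lipschitz_le h
        (fun r => hb.of_uncurry_left (x := r)) hc hlm hmn hT
    _ ≤ _ := add_le_add_left (add_le_add_right hfield _) _
    _ = _ := by ring

lemma exists_isSuperpositionLaw_of_tendsto {E : Type*} [NormedAddCommGroup E]
    [InnerProductSpace ℝ E] [ProperSpace E] [MeasurableSpace E] [BorelSpace E] {y w : S → ℝ → E}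
    {b : ℝ → E → E} (h : HasVelocity P y w) (hb : Measurable fun p : ℝ × E => b p.1 p.2)
    (hmean : ∀ q : ℚ, HasMeanVelocityAt P y w b q) {φ : ℕ → ℕ} (hφ : Tendsto φ atTop atTop)
    {T : ℝ} (hw : Tendsto (fun n => ∫⁻ u in Icc 0 T,
      ∫⁻ s, ‖w s (dyadicFloor (φ n) u) - w s u‖ₑ ∂P) atTop (𝓝 0))
    (hbw : Tendsto (fun n => ∫⁻ u in Icc 0 T, ∫⁻ s, ‖b (dyadicFloor (φ n) u)
      (y s (dyadicFloor (φ n) u)) - b u (y s u)‖ₑ ∂P) atTop (𝓝 0)) :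
    ∃ Q : ProbabilityMeasure (ℚ → E), IsSuperpositionLaw P y w b T Q := by
  have hy : ∀ r, Measurable fun s => y s r := fun r => h.measurable_position_at r
  let Q : ℕ → ProbabilityMeasure (ℚ → E) := fun n =>
    ⟨resampledLaw P y (φ n), isProbabilityMeasure_resampledLaw hy (φ n)⟩
  obtain ⟨Q', ψ, hψ, hlim⟩ := exists_subseq_tendsto_of_tight_marginals Q
    (isTightMeasureSet_range_map_resampledLaw h φ)
  have hφψ : Tendsto (φ ∘ ψ) atTop atTop := hφ.comp hψ.tendsto_atTop
  refine ⟨Q', map_eval_of_tendsto_resampledLaw hy hφψ (fun _ => rfl) hlim, ?_, ?_⟩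
  · intro n i j hij
    refine lintegral_enorm_le_of_tendsto hlim (by fun_prop) ?_ tendsto_const_nhds
    filter_upwards [hφψ.eventually_ge_atTop n] with k hk
    refine (lintegral_resampledLaw_sub_le h _
      (Rat.cast_le.1 (monotone_dyadicPt n hij))).trans_eq ?_
    rw [dyadicFloor_dyadicPt (n := φ (ψ k)) hk, dyadicFloor_dyadicPt (n := φ (ψ k)) hk]
  · intro K c hc l m j hlm hT
    have herr := ((tendsto_lintegral_resampledLaw_drift h
      (fun r => hb.of_uncurry_left (x := r)) hmean hφ hw hT).add hbw).comp hψ.tendsto_atTop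
    have hbound := herr.add_const ((∫⁻ u in Icc 0 T, ∫⁻ s, ‖b u (y s u) - c u (y s u)‖ₑ ∂P) +
      2 * (K * (ENNReal.ofReal ((1 / 2) ^ m) *
        (ENNReal.ofReal T + ∫⁻ u, ∫⁻ s, ‖w s u‖ₑ ∂P))))
    rw [add_zero, zero_add] at hbound
    refine lintegral_enorm_le_of_tendsto hlim (continuous_driftDefect (fun r =>
      hc.continuous.comp (by fun_prop : Continuous fun x : E => (r, x))) hlm j) ?_ hbound
    filter_upwards [hφψ.eventually_ge_atTop m] with n hn
    exact lintegral_resampledLaw_driftDefect_le_add h hb hc hlm hn hT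

end LimitLaw

section PathLimit

/-- The limit at the real time `u` of a path over rational times, along the dyadic approximations
of `u` from below. This is a junk value if the limit does not exist. -/
noncomputable def pathLimit {E : Type*} [TopologicalSpace E] [Nonempty E] (ω : ℚ → E) (u : ℝ) :
    E :=
  limUnder atTop fun n => ω (dyadicFloor n u)

lemma pathLimit_dyadicPt {E : Type*} [TopologicalSpace E] [T2Space E] [Nonempty E] (ω : ℚ → E)
    (n k : ℕ) : pathLimit ω (dyadicPt n k) = ω (dyadicPt n k) := by
  refine (tendsto_const_nhds.congr' ?_).limUnder_eq
  filter_upwards [eventually_ge_atTop n] with m hm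
  rw [dyadicFloor_dyadicPt hm]

variable {S : Type*} [MeasurableSpace S] {E : Type*} [NormedAddCommGroup E]
  [MeasurableSpace E] [BorelSpace E] [SecondCountableTopology E] [CompleteSpace E]

lemma measurable_pathLimit : Measurable fun p : (ℚ → E) × ℝ => pathLimit p.1 p.2 :=
  (StronglyMeasurable.limUnder fun n => (measurable_field_comp_dyadicFloor (b := fun _ x => x)
    (fun _ => measurable_id) n).stronglyMeasurable).measurable

lemma measurable_pathLimit_at (u : ℝ) : Measurable fun ω : ℚ → E => pathLimit ω u :=
  measurable_pathLimit.comp (by fun_prop : Measurable fun ω : ℚ → E => (ω, u))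

variable [NormedSpace ℝ E] {P : Measure S} {y w : S → ℝ → E} {b c : ℝ → E → E} {T : ℝ}
  {Q : Measure (ℚ → E)}

omit [MeasurableSpace E] [BorelSpace E] [SecondCountableTopology E] [CompleteSpace E] in
lemma enorm_sub_integral_le_driftDefect_add {l m j : ℕ} (hlm : l ≤ m) (hT : dyadicPt l j ≤ T)
    {ω : ℚ → E} (hω : IntegrableOn (fun u => b u (pathLimit ω u)) (Icc 0 T)) :
    ‖ω (dyadicPt l j) - ω 0 - ∫ u in (0 : ℝ)..dyadicPt l j, b u (pathLimit ω u)‖ₑ ≤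
      ‖driftDefect c m (dyadicPt l j) ω‖ₑ + ∫⁻ u in Icc 0 T,
        ‖c (dyadicFloor m u) (ω (dyadicFloor m u)) - b u (pathLimit ω u)‖ₑ := by
  obtain ⟨M, hM⟩ := exists_dyadicPt_eq hlm j
  have hzero : (0 : ℝ) ≤ dyadicPt l j := by rw [coe_dyadicPt]; positivity
  have hsub : Ioc (0 : ℝ) (dyadicPt l j) ⊆ Icc 0 T :=
    Ioc_subset_Icc_self.trans (Icc_subset_Icc le_rfl hT)
  have hc := intervalIntegrable_comp_dyadicFloor m (fun q : ℚ => c q (ω q)) M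
  rw [hM] at hc
  have hb : IntervalIntegrable (fun u => b u (pathLimit ω u)) volume 0 (dyadicPt l j) :=
    (intervalIntegrable_iff_integrableOn_Ioc_of_le hzero).2 (hω.mono_set hsub)
  have hsplit : ω (dyadicPt l j) - ω 0 - ∫ u in (0 : ℝ)..dyadicPt l j, b u (pathLimit ω u) =
      driftDefect c m (dyadicPt l j) ω + ∫ u in (0 : ℝ)..dyadicPt l j,
        (c (dyadicFloor m u) (ω (dyadicFloor m u)) - b u (pathLimit ω u)) := by
    rw [driftDefect, intervalIntegral.integral_sub hc hb, sub_add_sub_cancel]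
  rw [hsplit, intervalIntegral.integral_of_le hzero]
  exact (enorm_add_le _ _).trans (add_le_add_right
    ((enorm_integral_le_lintegral_enorm _).trans (lintegral_mono_set hsub)) _)

namespace IsSuperpositionLaw

omit [BorelSpace E] [SecondCountableTopology E] [CompleteSpace E] in
lemma lintegral_dyadicFloor_sub_le (hQ : IsSuperpositionLaw P y w b T Q) {m n : ℕ} (hmn : m ≤ n)
    {u : ℝ} (hu : 0 ≤ u) :
    ∫⁻ ω, ‖ω (dyadicFloor n u) - ω (dyadicFloor m u)‖ₑ ∂Q ≤
      ∫⁻ v in Ico (dyadicFloor m u : ℝ) (dyadicFloor n u), ∫⁻ s, ‖w s v‖ₑ ∂P := by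
  obtain ⟨i, hi⟩ := exists_dyadicPt_eq hmn ⌊u * 2 ^ m⌋₊
  have hle : (dyadicPt n i : ℝ) ≤ u := by rw [hi]; exact dyadicFloor_le m hu
  have hij : i ≤ ⌊u * 2 ^ n⌋₊ := by
    rw [← floor_dyadicPt n i]
    gcongr
  simpa only [hi, dyadicFloor] using hQ.lintegral_sub_le n i _ hij

lemma ae_tendsto_pathLimit (hQ : IsSuperpositionLaw P y w b T Q)
    (hfin : ∫⁻ v, ∫⁻ s, ‖w s v‖ₑ ∂P ≠ ⊤) {u : ℝ} (hu : 0 ≤ u) :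
    ∀ᵐ ω ∂Q, Tendsto (fun n => ω (dyadicFloor n u)) atTop (𝓝 (pathLimit ω u)) := by
  have hmeas : ∀ n, Measurable fun ω : ℚ → E =>
      ‖ω (dyadicFloor (n + 1) u) - ω (dyadicFloor n u)‖ₑ := fun n => by fun_prop
  have hsum : ∫⁻ ω, ∑' n, ‖ω (dyadicFloor (n + 1) u) - ω (dyadicFloor n u)‖ₑ ∂Q ≤
      ∫⁻ v, ∫⁻ s, ‖w s v‖ₑ ∂P := by
    rw [lintegral_tsum fun n => (hmeas n).aemeasurable]
    refine ENNReal.tsum_le_of_sum_range_le fun N => ?_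
    refine (Finset.sum_le_sum fun n _ =>
      hQ.lintegral_dyadicFloor_sub_le n.le_succ hu).trans ?_
    rw [Finset.range_eq_Ico, sum_setLIntegral_Ico (monotone_dyadicFloor_left hu) _ N.zero_le]
    exact setLIntegral_le_lintegral _ _
  filter_upwards [ae_lt_top (Measurable.tsum hmeas) (ne_top_of_le_ne_top hfin hsum)]
    with ω hω
  have hcauchy : CauchySeq fun n => ω (dyadicFloor n u) :=
    cauchySeq_of_edist_le_of_tsum_ne_top _ (fun n => by
      rw [edist_comm, edist_eq_enorm_sub]) hω.ne
  exact hcauchy.tendsto_limUnder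

lemma lintegral_dyadicFloor_sub_pathLimit_le (hQ : IsSuperpositionLaw P y w b T Q)
    (hfin : ∫⁻ v, ∫⁻ s, ‖w s v‖ₑ ∂P ≠ ⊤) (m : ℕ) {u : ℝ} (hu : 0 ≤ u) :
    ∫⁻ ω, ‖pathLimit ω u - ω (dyadicFloor m u)‖ₑ ∂Q ≤
      ∫⁻ v in Ico (dyadicFloor m u : ℝ) u, ∫⁻ s, ‖w s v‖ₑ ∂P := by
  rw [← eLpNorm_one_eq_lintegral_enorm]
  refine (Lp.eLpNorm_lim_le_liminf_eLpNorm
    (f := fun n (ω : ℚ → E) => ω (dyadicFloor n u) - ω (dyadicFloor m u))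
    (fun n => Measurable.aestronglyMeasurable (by fun_prop)) _ ?_).trans
    (liminf_le_of_frequently_le' (Eventually.frequently ?_))
  · filter_upwards [hQ.ae_tendsto_pathLimit hfin hu] with ω hω using hω.sub_const _
  · filter_upwards [eventually_ge_atTop m] with n hn
    rw [eLpNorm_one_eq_lintegral_enorm]
    exact (hQ.lintegral_dyadicFloor_sub_le hn hu).trans
      (lintegral_mono_set (Ico_subset_Ico_right (dyadicFloor_le n hu)))

variable [IsProbabilityMeasure P] [IsProbabilityMeasure Q]

lemma map_pathLimit (hQ : IsSuperpositionLaw P y w b T Q) (h : HasVelocity P y w) {u : ℝ}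
    (hu : 0 ≤ u) : Q.map (fun ω => pathLimit ω u) = P.map fun s => y s u := by
  have hlim := tendstoInDistribution_of_ae_tendsto
    (X := fun n (ω : ℚ → E) => ω (dyadicFloor n u)) (fun n => Measurable.aemeasurable (by fun_prop))
    (measurable_pathLimit_at u).aemeasurable
    (hQ.ae_tendsto_pathLimit h.lintegral_lintegral_velocity_ne_top hu)
  have hlim' := tendstoInDistribution_of_ae_tendsto (μ' := P)
    (X := fun n s => y s (dyadicFloor n u)) (fun n => (h.measurable_position_at _).aemeasurable)
    (h.measurable_position_at u).aemeasurable
    (ae_of_all _ fun s => (h.continuous_position s).continuousAt.tendsto.comp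
      (tendsto_dyadicFloor hu))
  have hlaw := tendsto_nhds_unique hlim.tendsto (hlim'.tendsto.congr fun n =>
    Subtype.ext (hQ.map_eval n _).symm)
  exact congrArg (fun μ : ProbabilityMeasure E => (μ : Measure E)) hlaw

lemma lintegral_comp_pathLimit (hQ : IsSuperpositionLaw P y w b T Q)
    (h : HasVelocity P y w) {F : ℝ → E → ENNReal}
    (hF : Measurable fun p : ℝ × E => F p.1 p.2) (T : ℝ) :
    ∫⁻ u in Icc 0 T, ∫⁻ ω, F u (pathLimit ω u) ∂Q = ∫⁻ u in Icc 0 T, ∫⁻ s, F u (y s u) ∂P := by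
  refine setLIntegral_congr_fun measurableSet_Icc fun u hu => ?_
  have hFu : Measurable (F u) := hF.comp measurable_prodMk_left
  calc ∫⁻ ω, F u (pathLimit ω u) ∂Q
      = ∫⁻ x, F u x ∂(Q.map fun ω => pathLimit ω u) :=
        (lintegral_map hFu (measurable_pathLimit_at u)).symm
    _ = ∫⁻ s, F u (y s u) ∂P := by
        rw [hQ.map_pathLimit h hu.1, lintegral_map hFu (h.measurable_position_at u)]

lemma ae_integrableOn_field (hQ : IsSuperpositionLaw P y w b T Q)
    (h : HasVelocity P y w) (hb : Measurable fun p : ℝ × E => b p.1 p.2)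
    (hfin : ∫⁻ u in Icc 0 T, ∫⁻ s, ‖b u (y s u)‖ₑ ∂P ≠ ⊤) :
    ∀ᵐ ω ∂Q, IntegrableOn (fun u => b u (pathLimit ω u)) (Icc 0 T) := by
  have hmeas : Measurable fun p : (ℚ → E) × ℝ => b p.2 (pathLimit p.1 p.2) :=
    hb.comp (measurable_snd.prodMk measurable_pathLimit)
  rw [← hQ.lintegral_comp_pathLimit h (F := fun u x => ‖b u x‖ₑ) hb.enorm,
    ← lintegral_lintegral_swap hmeas.enorm.aemeasurable] at hfin
  filter_upwards [ae_lt_top hmeas.enorm.lintegral_prod_right' hfin] with ω hω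
  exact ⟨(hmeas.comp measurable_prodMk_left).aestronglyMeasurable, hω⟩

lemma lintegral_lipschitz_comp_pathLimit_sub_le (hQ : IsSuperpositionLaw P y w b T Q)
    (h : HasVelocity P y w) {K : NNReal} (hc : LipschitzWith K fun p : ℝ × E => c p.1 p.2)
    (m : ℕ) :
    ∫⁻ u in Icc 0 T, ∫⁻ ω, ‖c (dyadicFloor m u) (ω (dyadicFloor m u)) -
        c u (pathLimit ω u)‖ₑ ∂Q ≤
      K * (ENNReal.ofReal ((1 / 2) ^ m) *
        (ENNReal.ofReal T + ∫⁻ v, ∫⁻ s, ‖w s v‖ₑ ∂P)) := by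
  refine lintegral_lipschitz_comp_sub_le hc h.measurable_lintegral_velocity
    (X := fun u (ω : ℚ → E) => ω (dyadicFloor m u)) (X' := fun u ω => pathLimit ω u)
    (fun u hu => abs_dyadicFloor_sub_le m hu.1) (fun u hu => ?_)
  refine le_of_eq_of_le (lintegral_congr fun ω => ?_)
    (hQ.lintegral_dyadicFloor_sub_pathLimit_le h.lintegral_lintegral_velocity_ne_top m hu.1)
  rw [← edist_eq_enorm_sub, edist_comm, edist_eq_enorm_sub]

lemma lintegral_lintegral_lipschitz_sub_field_pathLimit_le (hQ : IsSuperpositionLaw P y w b T Q)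
    (h : HasVelocity P y w) (hb : Measurable fun p : ℝ × E => b p.1 p.2) {K : NNReal}
    (hc : LipschitzWith K fun p : ℝ × E => c p.1 p.2) (m : ℕ) :
    ∫⁻ u in Icc 0 T, ∫⁻ ω, ‖c (dyadicFloor m u) (ω (dyadicFloor m u)) -
        b u (pathLimit ω u)‖ₑ ∂Q ≤
      K * (ENNReal.ofReal ((1 / 2) ^ m) * (ENNReal.ofReal T + ∫⁻ v, ∫⁻ s, ‖w s v‖ₑ ∂P)) +
      ∫⁻ u in Icc 0 T, ∫⁻ s, ‖b u (y s u) - c u (y s u)‖ₑ ∂P := by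
  have hcm : Measurable fun p : ℝ × E => c p.1 p.2 := hc.continuous.measurable
  have hpath : Measurable fun p : (ℚ → E) × ℝ => (p.2, pathLimit p.1 p.2) :=
    measurable_snd.prodMk measurable_pathLimit
  refine (lintegral_lintegral_enorm_sub_le_add (g := fun u ω => c u (pathLimit ω u))
    (measurable_field_comp_dyadicFloor (fun r => hcm.of_uncurry_left (x := r)) m)
    (hcm.comp hpath)).trans ?_
  refine add_le_add (hQ.lintegral_lipschitz_comp_pathLimit_sub_le h hc m) (le_of_eq ?_)
  rw [← hQ.lintegral_comp_pathLimit h (F := fun u x => ‖b u x - c u x‖ₑ) (hb.sub hcm).enorm]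
  simp only [← edist_eq_enorm_sub, edist_comm]

lemma lintegral_integralEquation_defect_le (hQ : IsSuperpositionLaw P y w b T Q)
    (h : HasVelocity P y w) (hb : Measurable fun p : ℝ × E => b p.1 p.2)
    (hfin : ∫⁻ u in Icc 0 T, ∫⁻ s, ‖b u (y s u)‖ₑ ∂P ≠ ⊤) {K : NNReal}
    (hc : LipschitzWith K fun p : ℝ × E => c p.1 p.2) {l m j : ℕ} (hlm : l ≤ m)
    (hT : dyadicPt l j ≤ T) :
    ∫⁻ ω, ‖ω (dyadicPt l j) - ω 0 - ∫ u in (0 : ℝ)..dyadicPt l j, b u (pathLimit ω u)‖ₑ ∂Q ≤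
      2 * (∫⁻ u in Icc 0 T, ∫⁻ s, ‖b u (y s u) - c u (y s u)‖ₑ ∂P) +
      3 * (K * (ENNReal.ofReal ((1 / 2) ^ m) *
        (ENNReal.ofReal T + ∫⁻ v, ∫⁻ s, ‖w s v‖ₑ ∂P))) := by
  have hcr : ∀ r, Measurable (c r) := fun r =>
    (hc.continuous.comp (by fun_prop : Continuous fun x : E => (r, x))).measurable
  have hpath : Measurable fun p : (ℚ → E) × ℝ => (p.2, pathLimit p.1 p.2) :=
    measurable_snd.prodMk measurable_pathLimit
  calc ∫⁻ ω, ‖ω (dyadicPt l j) - ω 0 - ∫ u in (0 : ℝ)..dyadicPt l j, b u (pathLimit ω u)‖ₑ ∂Q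
      ≤ ∫⁻ ω, (‖driftDefect c m (dyadicPt l j) ω‖ₑ + ∫⁻ u in Icc 0 T,
          ‖c (dyadicFloor m u) (ω (dyadicFloor m u)) - b u (pathLimit ω u)‖ₑ) ∂Q := by
        refine lintegral_mono_ae ?_
        filter_upwards [hQ.ae_integrableOn_field h hb hfin] with ω hω
        exact enorm_sub_integral_le_driftDefect_add hlm hT hω
    _ = ∫⁻ ω, ‖driftDefect c m (dyadicPt l j) ω‖ₑ ∂Q + ∫⁻ u in Icc 0 T, ∫⁻ ω,
          ‖c (dyadicFloor m u) (ω (dyadicFloor m u)) - b u (pathLimit ω u)‖ₑ ∂Q := by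
        rw [lintegral_add_left (measurable_driftDefect hcr hlm j).enorm]
        exact congrArg _ (lintegral_lintegral_swap
          ((measurable_field_comp_dyadicFloor hcr m).sub (hb.comp hpath)).enorm.aemeasurable)
    _ ≤ _ := add_le_add (hQ.lintegral_driftDefect_le K c hc l m j hlm hT)
        (hQ.lintegral_lintegral_lipschitz_sub_field_pathLimit_le h hb hc m)
    _ = _ := by ring

end IsSuperpositionLaw

end PathLimit

section SolutionLaw

variable {S : Type*} [MeasurableSpace S] {E : Type*} [NormedAddCommGroup E] [NormedSpace ℝ E]
  [ProperSpace E] [MeasurableSpace E] [BorelSpace E] {P : Measure S} [IsProbabilityMeasure P]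
  {y w : S → ℝ → E} {b : ℝ → E → E} {T : ℝ}

lemma exists_lipschitzWith_lintegral_sub_le (hy : Measurable fun p : S × ℝ => y p.1 p.2)
    (hb : Measurable fun p : ℝ × E => b p.1 p.2)
    (hfin : ∫⁻ u in Icc 0 T, ∫⁻ s, ‖b u (y s u)‖ₑ ∂P ≠ ⊤) {ε : ℝ} (hε : 0 < ε) :
    ∃ (K : NNReal) (c : ℝ → E → E), (LipschitzWith K fun p : ℝ × E => c p.1 p.2) ∧
      ∫⁻ u in Icc 0 T, ∫⁻ s, ‖b u (y s u) - c u (y s u)‖ₑ ∂P ≤ ENNReal.ofReal ε := by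
  have : FiniteDimensional ℝ E := FiniteDimensional.of_locallyCompactSpace ℝ
  have hpos : Measurable fun p : ℝ × S => (p.1, y p.2 p.1) :=
    measurable_fst.prodMk (hy.comp measurable_swap)
  set μ : Measure (ℝ × E) :=
    ((volume.restrict (Icc 0 T)).prod P).map fun p : ℝ × S => (p.1, y p.2 p.1) with hμ
  have hlint : ∀ F : ℝ × E → ENNReal, Measurable F →
      ∫⁻ p, F p ∂μ = ∫⁻ u in Icc 0 T, ∫⁻ s, F (u, y s u) ∂P := fun F hF => by
    rw [hμ, lintegral_map hF hpos]
    exact lintegral_prod _ (hF.comp hpos).aemeasurable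
  have hmem : MemLp (fun p : ℝ × E => b p.1 p.2) 1 μ :=
    ⟨hb.aestronglyMeasurable, by
      rw [eLpNorm_one_eq_lintegral_enorm, hlint _ hb.enorm]
      exact hfin.lt_top⟩
  obtain ⟨g, hgsupp, hg, hle⟩ := hmem.exist_eLpNorm_sub_le (by simp) le_rfl hε
  obtain ⟨K, hK⟩ := (hg.of_le (by simp : (1 : WithTop ℕ∞) ≤ _)).lipschitzWith_of_hasCompactSupport
    hgsupp one_ne_zero
  refine ⟨K, fun u x => g (u, x), hK, ?_⟩
  rw [eLpNorm_one_eq_lintegral_enorm,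
    hlint _ (hb.sub hg.continuous.measurable).enorm] at hle
  exact hle

lemma tendsto_mul_mesh_mul (K : NNReal) {A : ENNReal} (hA : A ≠ ⊤) :
    Tendsto (fun m : ℕ => 3 * (K * (ENNReal.ofReal ((1 / 2) ^ m) * A))) atTop (𝓝 0) := by
  have hpow : Tendsto (fun m : ℕ => ENNReal.ofReal ((1 / 2) ^ m)) atTop (𝓝 0) := by
    simpa using ENNReal.tendsto_ofReal
      (tendsto_pow_atTop_nhds_zero_of_lt_one (by norm_num : (0 : ℝ) ≤ 1 / 2) (by norm_num))
  simpa using ENNReal.Tendsto.const_mul (a := 3) (ENNReal.Tendsto.const_mul (a := K)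
    (ENNReal.Tendsto.mul_const hpow (Or.inr hA)) (Or.inr (by simp))) (Or.inr (by simp))

namespace IsSuperpositionLaw

variable {Q : Measure (ℚ → E)} [IsProbabilityMeasure Q]

lemma measurable_integral_field (hb : Measurable fun p : ℝ × E => b p.1 p.2) (r r' : ℝ) :
    Measurable fun ω : ℚ → E => ∫ u in r..r', b u (pathLimit ω u) := by
  have hmeas : Measurable fun p : (ℚ → E) × ℝ => b p.2 (pathLimit p.1 p.2) :=
    hb.comp (measurable_snd.prodMk measurable_pathLimit)
  exact (hmeas.stronglyMeasurable.integral_prod_right.sub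
    hmeas.stronglyMeasurable.integral_prod_right).measurable

lemma ae_dyadicPt_sub_eq_integral (hQ : IsSuperpositionLaw P y w b T Q)
    (h : HasVelocity P y w) (hb : Measurable fun p : ℝ × E => b p.1 p.2)
    (hfin : ∫⁻ u in Icc 0 T, ∫⁻ s, ‖b u (y s u)‖ₑ ∂P ≠ ⊤) {l j : ℕ} (hT : dyadicPt l j ≤ T) :
    ∀ᵐ ω ∂Q, ω (dyadicPt l j) - ω 0 = ∫ u in (0 : ℝ)..dyadicPt l j, b u (pathLimit ω u) := by
  have hsmall : ∀ ε : ℝ, 0 < ε → ∫⁻ ω, ‖ω (dyadicPt l j) - ω 0 -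
      ∫ u in (0 : ℝ)..dyadicPt l j, b u (pathLimit ω u)‖ₑ ∂Q ≤ 2 * ENNReal.ofReal ε := by
    intro ε hε
    obtain ⟨K, c, hc, hle⟩ :=
      exists_lipschitzWith_lintegral_sub_le h.measurable_position hb hfin hε
    have hfinA : ENNReal.ofReal T + ∫⁻ v, ∫⁻ s, ‖w s v‖ₑ ∂P ≠ ⊤ :=
      ENNReal.add_ne_top.2 ⟨ENNReal.ofReal_ne_top, h.lintegral_lintegral_velocity_ne_top⟩
    have hmesh := (tendsto_mul_mesh_mul K hfinA).const_add (2 * ENNReal.ofReal ε)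
    rw [add_zero] at hmesh
    refine ge_of_tendsto hmesh ((eventually_ge_atTop l).mono fun m hlm => ?_)
    exact (hQ.lintegral_integralEquation_defect_le h hb hfin hc hlm hT).trans (by gcongr)
  have hzero : ∫⁻ ω, ‖ω (dyadicPt l j) - ω 0 -
      ∫ u in (0 : ℝ)..dyadicPt l j, b u (pathLimit ω u)‖ₑ ∂Q = 0 := by
    refine le_antisymm (ge_of_tendsto (x := 𝓝[>] (0 : ℝ)) (f := fun ε => 2 * ENNReal.ofReal ε) ?_
      (eventually_mem_nhdsWithin.mono hsmall)) bot_le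
    have hcont : Continuous fun ε : ℝ => 2 * ENNReal.ofReal ε :=
      (ENNReal.continuous_const_mul (by simp)).comp ENNReal.continuous_ofReal
    simpa using (hcont.tendsto 0).mono_left nhdsWithin_le_nhds
  have hmeas : Measurable fun ω : ℚ → E => ω (dyadicPt l j) - ω 0 -
      ∫ u in (0 : ℝ)..dyadicPt l j, b u (pathLimit ω u) :=
    .sub (by fun_prop) (measurable_integral_field hb _ _)
  filter_upwards [(lintegral_eq_zero_iff hmeas.enorm).1 hzero] with ω hω
  exact sub_eq_zero.1 (enorm_eq_zero.1 hω)

lemma ae_pathLimit_eq_add_integral (hQ : IsSuperpositionLaw P y w b T Q)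
    (h : HasVelocity P y w) (hb : Measurable fun p : ℝ × E => b p.1 p.2)
    (hfin : ∫⁻ u in Icc 0 T, ∫⁻ s, ‖b u (y s u)‖ₑ ∂P ≠ ⊤) :
    ∀ᵐ ω ∂Q, IntegrableOn (fun u => b u (pathLimit ω u)) (Icc 0 T) ∧
      ∀ t ∈ Icc 0 T, pathLimit ω t = pathLimit ω 0 + ∫ u in (0 : ℝ)..t, b u (pathLimit ω u) := by
  have hdyadic : ∀ᵐ ω ∂Q, ∀ l j, dyadicPt l j ≤ T →
      ω (dyadicPt l j) - ω 0 = ∫ u in (0 : ℝ)..dyadicPt l j, b u (pathLimit ω u) :=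
    ae_all_iff.2 fun l => ae_all_iff.2 fun j => by
      by_cases hT : (dyadicPt l j : ℝ) ≤ T
      · exact (hQ.ae_dyadicPt_sub_eq_integral h hb hfin hT).mono fun ω hω _ => hω
      · exact ae_of_all _ fun ω hω => absurd hω hT
  filter_upwards [hQ.ae_integrableOn_field h hb hfin, hdyadic] with ω hint hω
  refine ⟨hint, fun t ht => Tendsto.limUnder_eq ?_⟩
  have hzero : pathLimit ω 0 = ω 0 := by
    have := pathLimit_dyadicPt ω 0 0
    rwa [dyadicPt_zero_right, Rat.cast_zero] at this
  have hprimitive := intervalIntegral.continuousOn_primitive_interval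
    (by rwa [uIcc_of_le (ht.1.trans ht.2)] : IntegrableOn (fun u => b u (pathLimit ω u)) (uIcc 0 T))
  rw [uIcc_of_le (ht.1.trans ht.2)] at hprimitive
  have hle : ∀ n, (dyadicFloor n t : ℝ) ≤ T := fun n => (dyadicFloor_le n ht.1).trans ht.2
  have hlim := (hprimitive t ht).tendsto.comp (tendsto_nhdsWithin_iff.2
    ⟨tendsto_dyadicFloor ht.1, Eventually.of_forall fun n => ⟨dyadicFloor_nonneg n t, hle n⟩⟩)
  rw [hzero]
  refine (hlim.const_add (ω 0)).congr fun n => ?_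
  exact (sub_eq_iff_eq_add'.1 (hω n _ (hle n))).symm

end IsSuperpositionLaw

end SolutionLaw

section Superposition

variable {S : Type*} [MeasurableSpace S] {E : Type*} [NormedAddCommGroup E] [MeasurableSpace E]
  {P : Measure S} {y w : S → ℝ → E} {b : ℝ → E → E}

lemma lintegral_lintegral_field_le [NormedSpace ℝ E] [CompleteSpace E]
    (hmean : ∀ᵐ t, HasMeanVelocityAt P y w b t) :
    ∫⁻ t, ∫⁻ s, ‖b t (y s t)‖ₑ ∂P ≤ ∫⁻ t, ∫⁻ s, ‖w s t‖ₑ ∂P :=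
  lintegral_mono_ae (hmean.mono fun _ ht => ht.lintegral_field_le)

lemma HasVelocity.comp_sub_right [NormedSpace ℝ E] (h : HasVelocity P y w) (U : ℝ) :
    HasVelocity P (fun s r => y s (r - U)) (fun s r => w s (r - U)) where
  measurable_position := h.measurable_position.comp
    (by fun_prop : Measurable fun p : S × ℝ => (p.1, p.2 - U))
  measurable_velocity := h.measurable_velocity.comp
    (by fun_prop : Measurable fun p : S × ℝ => (p.1, p.2 - U))
  integrable_velocity s := (h.integrable_velocity s).comp_sub_right U
  integral_velocity s a c := by
    rw [h.integral_velocity, intervalIntegral.integral_comp_sub_right (w s)]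
  lintegral_velocity_ne_top := ne_of_eq_of_ne (lintegral_congr fun s =>
    lintegral_sub_right_eq_self (fun r => ‖w s r‖ₑ) U) h.lintegral_velocity_ne_top

variable [InnerProductSpace ℝ E] [ProperSpace E] [BorelSpace E] [IsProbabilityMeasure P]

lemma exists_shift_isSuperpositionLaw (h : HasVelocity P y w)
    (hb : Measurable fun p : ℝ × E => b p.1 p.2) (hmean : ∀ᵐ t, HasMeanVelocityAt P y w b t)
    (T : ℝ) :
    ∃ U ∈ Icc (0 : ℝ) 1, ∃ Q : ProbabilityMeasure (ℚ → E), IsSuperpositionLaw P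
      (fun s r => y s (r - U)) (fun s r => w s (r - U)) (fun r => b (r - U)) T Q := by
  have hfield : Measurable fun p : S × ℝ => b p.2 (y p.1 p.2) :=
    hb.comp (measurable_snd.prodMk h.measurable_position)
  have hfin : ∫⁻ s, (∫⁻ r, ‖b r (y s r)‖ₑ) ∂P ≠ ⊤ := by
    rw [lintegral_lintegral_swap hfield.enorm.aemeasurable]
    exact ne_top_of_le_ne_top h.lintegral_lintegral_velocity_ne_top
      (lintegral_lintegral_field_le hmean)
  obtain ⟨U, hU, hmeanU, φ, hφ, hw, hby⟩ := exists_shift_tendsto_stepError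
    (g := fun s r => b r (y s r)) h.measurable_velocity h.lintegral_velocity_ne_top hfield hfin T
    hmean
  have hbU : Measurable fun p : ℝ × E => b (p.1 - U) p.2 :=
    hb.comp (by fun_prop : Measurable fun p : ℝ × E => (p.1 - U, p.2))
  exact ⟨U, hU, exists_isSuperpositionLaw_of_tendsto (h.comp_sub_right U) hbU
    (fun q => ⟨(hmeanU q).integrable, (hmeanU q).condExp_ae_eq⟩) hφ hw hby⟩

theorem HasVelocity.exists_superposition (h : HasVelocity P y w)
    (hb : Measurable fun p : ℝ × E => b p.1 p.2) (hmean : ∀ᵐ t, HasMeanVelocityAt P y w b t)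
    (T : ℝ) :
    ∃ (Q : ProbabilityMeasure (ℚ → E)) (Γ : (ℚ → E) → ℝ → E),
      (∀ t, Measurable fun ω => Γ ω t) ∧
      (∀ t, 0 ≤ t → Measure.map (fun ω => Γ ω t) Q = P.map fun s => y s t) ∧
      ∀ᵐ ω ∂(Q : Measure (ℚ → E)), IntegrableOn (fun u => b u (Γ ω u)) (Icc 0 T) ∧
        ∀ t ∈ Icc 0 T, Γ ω t = Γ ω 0 + ∫ u in (0 : ℝ)..t, b u (Γ ω u) := by
  obtain ⟨U, hU, Q, hQ⟩ := exists_shift_isSuperpositionLaw h hb hmean (T + 1)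
  have hbU : Measurable fun p : ℝ × E => b (p.1 - U) p.2 :=
    hb.comp (by fun_prop : Measurable fun p : ℝ × E => (p.1 - U, p.2))
  have hfin : ∫⁻ u in Icc 0 (T + 1), ∫⁻ s, ‖b (u - U) (y s (u - U))‖ₑ ∂P ≠ ⊤ := by
    refine ne_top_of_le_ne_top h.lintegral_lintegral_velocity_ne_top
      ((setLIntegral_le_lintegral _ _).trans ?_)
    rw [lintegral_sub_right_eq_self (fun u => ∫⁻ s, ‖b u (y s u)‖ₑ ∂P) U]
    exact lintegral_lintegral_field_le hmean
  refine ⟨Q, fun ω t => pathLimit ω (t + U), fun t => measurable_pathLimit_at _, fun t ht => ?_, ?_⟩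
  · simpa using hQ.map_pathLimit (h.comp_sub_right U) (add_nonneg ht hU.1)
  filter_upwards [hQ.ae_pathLimit_eq_add_integral (h.comp_sub_right U) hbU hfin]
    with ω ⟨hint, hsol⟩
  have hsub : IntegrableOn (fun u => b (u - U) (pathLimit ω u)) (Icc U (T + U)) :=
    hint.mono_set (Icc_subset_Icc hU.1 (by linarith [hU.2]))
  have hshift := ((measurePreserving_add_right volume U).integrableOn_comp_preimage
    (measurableEmbedding_addRight U)).2 hsub
  refine ⟨by simpa [Function.comp_def] using hshift, fun t ht => ?_⟩
  have hII : ∀ t ∈ Icc 0 (T + 1),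
      IntervalIntegrable (fun u => b (u - U) (pathLimit ω u)) volume 0 t := fun t ht =>
    (intervalIntegrable_iff_integrableOn_Icc_of_le ht.1).2
      (hint.mono_set (Icc_subset_Icc_right ht.2))
  have htU : t + U ∈ Icc 0 (T + 1) := ⟨by linarith [ht.1, hU.1], by linarith [ht.2, hU.2]⟩
  have hU' : U ∈ Icc 0 (T + 1) := ⟨hU.1, by linarith [ht.1, ht.2, hU.2]⟩
  have hchange := intervalIntegral.integral_comp_add_right (a := 0) (b := t)
    (fun u => b (u - U) (pathLimit ω u)) U
  simp only [add_sub_cancel_right, zero_add] at hchange ⊢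
  rw [hchange, hsol _ htU, hsol _ hU', add_assoc, add_right_inj, ← sub_eq_iff_eq_add',
    intervalIntegral.integral_interval_sub_left (hII _ htU) (hII _ hU')]

end Superposition

section MeanVelocity

lemma condExp_map_comp_ae_eq {S T F : Type*} {mS : MeasurableSpace S} {m mT : MeasurableSpace T}
    [NormedAddCommGroup F] [NormedSpace ℝ F] [CompleteSpace F] {P : Measure S} [IsFiniteMeasure P]
    {f : S → T} (hf : Measurable f) (hm : m ≤ mT) {Y : T → F} (hY : Integrable Y (P.map f)) :
    (fun s => ((P.map f)[Y | m]) (f s)) =ᵐ[P] P[fun s => Y (f s) | m.comap f] := by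
  have hcomap : m.comap f ≤ mS := (MeasurableSpace.comap_mono hm).trans hf.comap_le
  have hcond : StronglyMeasurable[m] ((P.map f)[Y | m]) := stronglyMeasurable_condExp
  have hint : Integrable (fun s => ((P.map f)[Y | m]) (f s)) P :=
    integrable_condExp.comp_measurable hf
  refine ae_eq_condExp_of_forall_setIntegral_eq hcomap (hY.comp_measurable hf)
    (fun _ _ _ => hint.integrableOn) ?_
    (hcond.comp_measurable (comap_measurable f)).aestronglyMeasurable
  rintro _ ⟨B, hB, rfl⟩ -
  rw [← setIntegral_map (hm B hB) (hcond.mono hm).aestronglyMeasurable hf.aemeasurable,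
    ← setIntegral_map (hm B hB) hY.aestronglyMeasurable hf.aemeasurable,
    setIntegral_condExp hm hY hB]

variable {S : Type*} [MeasurableSpace S] {P : Measure S} {E : Type*} [NormedAddCommGroup E]
  [NormedSpace ℝ E] [MeasurableSpace E] {y w : S → ℝ → E}

lemma HasVelocity.ae_integrable_velocity [BorelSpace E] [SecondCountableTopology E]
    [SFinite P] (h : HasVelocity P y w) : ∀ᵐ t, Integrable (fun s => w s t) P := by
  filter_upwards [ae_lt_top h.measurable_velocity.enorm.lintegral_prod_left'
    h.lintegral_lintegral_velocity_ne_top] with t ht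
  exact ⟨(h.measurable_velocity.comp
    (by fun_prop : Measurable fun s : S => (s, t))).aestronglyMeasurable, ht⟩

lemma exists_measurable_ae_eq_integral_condDistrib [CompleteSpace E] [BorelSpace E]
    [SecondCountableTopology E] [IsFiniteMeasure P] (hy : Measurable fun p : S × ℝ => y p.1 p.2)
    (hw : Measurable fun p : S × ℝ => w p.1 p.2) :
    ∃ b : ℝ → E → E, (Measurable fun p : ℝ × E => b p.1 p.2) ∧ ∀ t, b t =ᵐ[P.map fun s => y s t]
      fun x => ∫ u, u ∂condDistrib (fun s => w s t) (fun s => y s t) P x := by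
  have hyw : Measurable fun p : ℝ × S => (y p.2 p.1, w p.2 p.1) :=
    (hy.comp measurable_swap).prodMk (hw.comp measurable_swap)
  have hyt (t : ℝ) : Measurable fun s => y s t := hyw.fst.comp measurable_prodMk_left
  have hwt (t : ℝ) : Measurable fun s => w s t := hyw.snd.comp measurable_prodMk_left
  let κ : Kernel ℝ (E × E) :=
    (Kernel.id ×ₖ Kernel.const ℝ P).map fun p : ℝ × S => (y p.2 p.1, w p.2 p.1)
  have hκ (t : ℝ) : κ t = P.map fun s => (y s t, w s t) := by
    simp only [κ]
    rw [Kernel.map_apply _ hyw, Kernel.prod_apply, Kernel.id_apply, Kernel.const_apply,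
      Measure.dirac_prod, Measure.map_map hyw (by fun_prop)]
    rfl
  have hκfst (t : ℝ) : κ.fst t = P.map fun s => y s t := by
    rw [Kernel.fst_apply, hκ, Measure.map_map measurable_fst ((hyt t).prodMk (hwt t))]
    rfl
  refine ⟨fun t x => ∫ u, u ∂κ.condKernel (t, x), (StronglyMeasurable.integral_kernel
    (f := fun u : E => u) stronglyMeasurable_id).measurable, fun t => ?_⟩
  have hdisint := condDistrib_ae_eq_of_measure_eq_compProd (μ := P) (fun s => y s t)
    (hwt t).aemeasurable (κ := κ.condKernel.comap (Prod.mk t) measurable_prodMk_left) (by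
      rw [← hκ, ← hκfst]
      nth_rw 1 [← κ.disintegrate κ.condKernel]
      rw [Kernel.compProd_apply_eq_compProd_sectR]
      rfl)
  filter_upwards [hdisint] with x hx
  rw [hx]
  rfl

theorem HasVelocity.exists_hasMeanVelocityAt [CompleteSpace E] [BorelSpace E]
    [SecondCountableTopology E] [IsFiniteMeasure P] (h : HasVelocity P y w) :
    ∃ b : ℝ → E → E, (Measurable fun p : ℝ × E => b p.1 p.2) ∧
      ∀ᵐ t, HasMeanVelocityAt P y w b t := by
  obtain ⟨b, hb, hbt⟩ := exists_measurable_ae_eq_integral_condDistrib (P := P)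
    h.measurable_position h.measurable_velocity
  refine ⟨b, hb, h.ae_integrable_velocity.mono fun t ht => ⟨ht, ?_⟩⟩
  have hyt := h.measurable_position_at t
  exact (condExp_ae_eq_integral_condDistrib' hyt ht).trans
    (EventuallyEq.symm (ae_of_ae_map hyt.aemeasurable (hbt t)))

end MeanVelocity

section Trajectory

variable {d : ℕ} {v : FlowField d} {x₁ : EuclideanSpace ℝ (Fin d)}
  {γ : ℝ → EuclideanSpace ℝ (Fin d)}

lemma WellPosedAt.isTrajectory_runFlow (h : WellPosedAt v x₁) :
    IsTrajectory v x₁ (runFlow v x₁) := by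
  have heq : runFlow v x₁ = h.1.choose := funext fun t => by simp only [runFlow, dif_pos h.1]
  rw [heq]
  exact h.1.choose_spec

lemma WellPosedAt.eqOn_runFlow (h : WellPosedAt v x₁) (hγ : IsTrajectory v x₁ γ) :
    EqOn (runFlow v x₁) γ (Icc 0 1) :=
  h.2 _ _ h.isTrajectory_runFlow hγ

lemma WellPosedAt.runFlow_one (h : WellPosedAt v x₁) : runFlow v x₁ 1 = x₁ := by
  simpa using h.isTrajectory_runFlow.2 1 ⟨zero_le_one, le_rfl⟩

lemma IsTrajectory.continuousOn (h : IsTrajectory v x₁ γ) : ContinuousOn γ (Icc 0 1) := by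
  have hint : IntegrableOn (fun s => v s (γ s)) (uIcc 1 0) := by
    rw [uIcc_of_ge zero_le_one]
    exact (intervalIntegrable_iff_integrableOn_Icc_of_le zero_le_one).1 h.1
  have hcont := intervalIntegral.continuousOn_primitive_interval hint
  rw [uIcc_of_ge zero_le_one] at hcont
  refine (continuousOn_const.sub hcont : ContinuousOn (fun t => x₁ - _) _).congr fun t ht => ?_
  rw [h.2 t ht, intervalIntegral.integral_symm, sub_eq_add_neg]
  rfl

lemma integral_indicator_Icc_eq_integral_projIcc {F : Type*} [NormedAddCommGroup F]
    [NormedSpace ℝ F] {a b : ℝ} (hab : a ≤ b) (f : ℝ → F) (r : ℝ) :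
    ∫ u in a..r, (Icc a b).indicator f u = ∫ u in a..(projIcc a b hab r : ℝ), f u := by
  rcases le_total r a with hr | hr
  · rw [projIcc_of_le_left hab hr, intervalIntegral.integral_same, intervalIntegral.integral_symm,
      intervalIntegral.integral_of_le hr, ← integral_Ico_eq_integral_Ioc,
      setIntegral_eq_zero_of_forall_eq_zero, neg_zero]
    exact fun u hu => indicator_of_notMem (fun hu' => hu'.1.not_gt hu.2) _
  · have hset : Ioc a r ∩ Icc a b = Ioc a (projIcc a b hab r) := by
      ext u
      simp only [mem_inter_iff, mem_Ioc, mem_Icc, coe_projIcc, le_max_iff, le_min_iff]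
      grind
    rw [intervalIntegral.integral_of_le hr, setIntegral_indicator measurableSet_Icc, hset,
      intervalIntegral.integral_of_le (projIcc a b hab r).2.1]

lemma one_sub_mem_Icc {t : ℝ} (ht : t ∈ Icc (0 : ℝ) 1) : 1 - t ∈ Icc (0 : ℝ) 1 :=
  ⟨by linarith [ht.2], by linarith [ht.1]⟩

/-- The field `r ↦ v (1 - r)` which runs the flow of `v` forward in time, cut off outside
`[0, 1]`. -/
noncomputable def reversedField (v : FlowField d) : FlowField d :=
  fun r x => (Icc (0 : ℝ) 1).indicator (fun r => v (1 - r) x) r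

/-- The path `r ↦ γ (1 - r)`, stopped outside `[0, 1]`. -/
noncomputable def reversedPath {F : Type*} (γ : ℝ → F) (r : ℝ) : F :=
  γ (1 - projIcc (0 : ℝ) 1 zero_le_one r)

lemma reversedField_of_mem {r : ℝ} (hr : r ∈ Icc (0 : ℝ) 1) (x : EuclideanSpace ℝ (Fin d)) :
    reversedField v r x = v (1 - r) x :=
  indicator_of_mem hr _

lemma reversedField_of_notMem {r : ℝ} (hr : r ∉ Icc (0 : ℝ) 1) (x : EuclideanSpace ℝ (Fin d)) :
    reversedField v r x = 0 :=
  indicator_of_notMem hr _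

lemma reversedPath_of_mem {r : ℝ} (hr : r ∈ Icc (0 : ℝ) 1) : reversedPath γ r = γ (1 - r) := by
  rw [reversedPath, projIcc_of_mem _ hr]

lemma reversedField_reversedPath (v : FlowField d) (γ : ℝ → EuclideanSpace ℝ (Fin d)) :
    (fun r => reversedField v r (reversedPath γ r)) =
      (Icc (0 : ℝ) 1).indicator fun r => v (1 - r) (γ (1 - r)) := by
  ext1 r
  by_cases hr : r ∈ Icc (0 : ℝ) 1
  · rw [reversedField_of_mem hr, reversedPath_of_mem hr, indicator_of_mem hr]
  · rw [reversedField_of_notMem hr, indicator_of_notMem hr]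

lemma measurable_reversedField {α : Type*} [MeasurableSpace α] {V : α → FlowField d}
    (hV : Measurable fun z : α × ℝ × EuclideanSpace ℝ (Fin d) => V z.1 z.2.1 z.2.2) :
    Measurable fun z : α × ℝ × EuclideanSpace ℝ (Fin d) =>
      reversedField (V z.1) z.2.1 z.2.2 := by
  have hind : (fun z : α × ℝ × EuclideanSpace ℝ (Fin d) => reversedField (V z.1) z.2.1 z.2.2) =
      {z | z.2.1 ∈ Icc (0 : ℝ) 1}.indicator fun z => V z.1 (1 - z.2.1) z.2.2 := rfl
  rw [hind]
  exact (hV.comp (by fun_prop : Measurable fun z : α × ℝ × EuclideanSpace ℝ (Fin d) =>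
    (z.1, 1 - z.2.1, z.2.2))).indicator (measurable_snd.fst measurableSet_Icc)

lemma measurable_reversedPath {S F : Type*} [MeasurableSpace S] [TopologicalSpace F]
    [TopologicalSpace.PseudoMetrizableSpace F] [MeasurableSpace F] [BorelSpace F]
    {γ : S → ℝ → F} (hγ : ∀ t ∈ Icc (0 : ℝ) 1, Measurable fun s => γ s t)
    (hcont : ∀ s, ContinuousOn (γ s) (Icc 0 1)) :
    Measurable fun p : S × ℝ => reversedPath (γ p.1) p.2 := by
  have hmem (r : ℝ) := one_sub_mem_Icc (projIcc (0 : ℝ) 1 zero_le_one r).2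
  exact (measurable_uncurry_of_continuous_of_measurable (u := fun r s => reversedPath (γ s) r)
    (fun s => (hcont s).comp_continuous (by fun_prop) hmem)
    fun r => hγ _ (hmem r)).comp measurable_swap

namespace IsTrajectory

lemma integrable_reversedField (h : IsTrajectory v x₁ γ) :
    Integrable fun r => reversedField v r (reversedPath γ r) := by
  rw [reversedField_reversedPath, integrable_indicator_iff measurableSet_Icc,
    ← intervalIntegrable_iff_integrableOn_Icc_of_le zero_le_one]
  simpa using (h.1.comp_sub_left 1).symm

lemma reversedPath_eq (h : IsTrajectory v x₁ γ) (r : ℝ) :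
    reversedPath γ r = x₁ + ∫ u in (0 : ℝ)..r, reversedField v u (reversedPath γ u) := by
  rw [reversedField_reversedPath, integral_indicator_Icc_eq_integral_projIcc zero_le_one,
    intervalIntegral.integral_comp_sub_left (fun s => v s (γ s)), sub_zero]
  exact h.2 _ (one_sub_mem_Icc (projIcc (0 : ℝ) 1 zero_le_one r).2)

lemma reversedPath_sub (h : IsTrajectory v x₁ γ) (a b : ℝ) :
    reversedPath γ b - reversedPath γ a =
      ∫ u in a..b, reversedField v u (reversedPath γ u) := by
  have hint := h.integrable_reversedField
  rw [h.reversedPath_eq b, h.reversedPath_eq a, add_sub_add_left_eq_sub,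
    intervalIntegral.integral_interval_sub_left hint.intervalIntegrable hint.intervalIntegrable]

lemma of_reversed {ρ : ℝ → EuclideanSpace ℝ (Fin d)}
    (hint : IntegrableOn (fun r => reversedField v r (ρ r)) (Icc 0 1))
    (hρ : ∀ t ∈ Icc (0 : ℝ) 1, ρ t = x₁ + ∫ r in (0 : ℝ)..t, reversedField v r (ρ r)) :
    IsTrajectory v x₁ fun t => ρ (1 - t) := by
  have hfield : EqOn (fun t => reversedField v (1 - t) (ρ (1 - t))) (fun t => v t (ρ (1 - t)))
      (Icc 0 1) := fun t ht => by
    simp only [reversedField_of_mem (one_sub_mem_Icc ht), sub_sub_cancel]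
  constructor
  · have hII := ((intervalIntegrable_iff_integrableOn_Icc_of_le zero_le_one).2 hint).comp_sub_left 1
    rw [sub_zero, sub_self] at hII
    refine hII.symm.congr fun t ht => hfield ?_
    rw [uIoc_of_le zero_le_one] at ht
    exact Ioc_subset_Icc_self ht
  · intro t ht
    have hchange := intervalIntegral.integral_comp_sub_left (a := t) (b := 1)
      (fun r => reversedField v r (ρ r)) 1
    rw [sub_self] at hchange
    refine (hρ _ (one_sub_mem_Icc ht)).trans ?_
    rw [← hchange]
    refine congrArg _ (intervalIntegral.integral_congr fun s hs => hfield ?_)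
    rw [uIcc_of_le ht.2] at hs
    exact ⟨ht.1.trans hs.1, hs.2⟩

end IsTrajectory

end Trajectory

section Reversal

variable {d : ℕ} {S : Type*} [MeasurableSpace S] {P : Measure S} {V : S → FlowField d}
  {X : S → EuclideanSpace ℝ (Fin d)} {y w : S → ℝ → EuclideanSpace ℝ (Fin d)}

/-- `y` and `w` are everywhere defined, jointly measurable versions of the positions and velocities
of the random flow `V` started from `X`, in the reversed time `r = 1 - t` and stopped outside
`[0, 1]`. -/
structure IsReversal (P : Measure S) (V : S → FlowField d) (X : S → EuclideanSpace ℝ (Fin d))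
    (y w : S → ℝ → EuclideanSpace ℝ (Fin d)) : Prop where
  measurable_position : Measurable fun p : S × ℝ => y p.1 p.2
  measurable_velocity : Measurable fun p : S × ℝ => w p.1 p.2
  integrable_velocity : ∀ s, Integrable (w s)
  integral_velocity : ∀ s a b, y s b - y s a = ∫ r in a..b, w s r
  velocity_eq_zero : ∀ s, ∀ r ∉ Icc (0 : ℝ) 1, w s r = 0
  start_ae_eq : ∀ᵐ s ∂P, y s 0 = X s
  ae_eq : ∀ᵐ s ∂P, ∀ t ∈ Icc (0 : ℝ) 1, y s (1 - t) = runFlow (V s) (X s) t ∧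
    w s (1 - t) = V s t (runFlow (V s) (X s) t)

namespace IsRegularRandomFlow

/-- The positions at rational times have measurable versions; off the null set where these differ
from the positions, or where the flow is not well posed, all positions are limits of them. -/
lemma exists_measurable_position (h : IsRegularRandomFlow P V X) :
    ∃ N : Set S, MeasurableSet N ∧ P N = 0 ∧ (∀ s ∉ N, WellPosedAt (V s) (X s)) ∧
      ∀ t ∈ Icc (0 : ℝ) 1, Measurable (Nᶜ.indicator fun s => runFlow (V s) (X s) t) := by
  let good (s : S) : Prop := WellPosedAt (V s) (X s) ∧ ∀ (q : ℚ) (hq : (q : ℝ) ∈ Icc (0 : ℝ) 1),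
    runFlow (V s) (X s) q = (h.aemeasurable_position q hq).mk _ s
  have hgood : ∀ᵐ s ∂P, good s := by
    refine h.wellPosed.and (ae_all_iff.2 fun q => ?_)
    by_cases hq : (q : ℝ) ∈ Icc (0 : ℝ) 1
    · filter_upwards [(h.aemeasurable_position q hq).ae_eq_mk] with s hs _ using hs
    · exact ae_of_all _ fun s hq' => absurd hq' hq
  set N := toMeasurable P {s | ¬ good s}
  have hgoodN : ∀ s ∉ N, good s := fun s hs =>
    not_not.1 fun h' => hs (subset_toMeasurable _ _ h')
  refine ⟨N, measurableSet_toMeasurable _ _, (measure_toMeasurable _).trans (ae_iff.1 hgood),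
    fun s hs => (hgoodN s hs).1, fun t ht => ?_⟩
  have hgrid (n : ℕ) : ((dyadicFloor n t : ℚ) : ℝ) ∈ Icc (0 : ℝ) 1 :=
    ⟨by exact_mod_cast dyadicFloor_nonneg n t, (dyadicFloor_le n ht.1).trans ht.2⟩
  refine measurable_of_tendsto_metrizable (f := fun n => Nᶜ.indicator
    ((h.aemeasurable_position _ (hgrid n)).mk _)) (fun n => (AEMeasurable.measurable_mk _).indicator
      (measurableSet_toMeasurable _ _).compl) (tendsto_pi_nhds.2 fun s => ?_)
  by_cases hs : s ∈ N
  · simp [hs]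
  · simp only [indicator_of_mem (show s ∈ Nᶜ from hs)]
    have hcont := (hgoodN s hs).1.isTrajectory_runFlow.continuousOn t ht
    exact (hcont.tendsto.comp (tendsto_nhdsWithin_iff.2
      ⟨tendsto_dyadicFloor ht.1, Eventually.of_forall hgrid⟩)).congr
        fun n => (hgoodN s hs).2 _ (hgrid n)

lemma exists_measurable_trajectory (h : IsRegularRandomFlow P V X) :
    ∃ (V' : S → FlowField d) (γ : S → ℝ → EuclideanSpace ℝ (Fin d)),
      (Measurable fun z : S × ℝ × EuclideanSpace ℝ (Fin d) => V' z.1 z.2.1 z.2.2) ∧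
      (∀ t ∈ Icc (0 : ℝ) 1, Measurable fun s => γ s t) ∧
      (∀ s, IsTrajectory (V' s) (γ s 1) (γ s)) ∧
      ∀ᵐ s ∂P, V' s = V s ∧ γ s = runFlow (V s) (X s) ∧ γ s 1 = X s := by
  obtain ⟨N, hN, hN0, hwp, hmeas⟩ := h.exists_measurable_position
  refine ⟨Nᶜ.indicator V, fun s t => Nᶜ.indicator (fun s => runFlow (V s) (X s) t) s, ?_, hmeas,
    fun s => ?_, (measure_eq_zero_iff_ae_notMem.1 hN0).mono fun s hs => ?_⟩
  · have hind : (fun z : S × ℝ × EuclideanSpace ℝ (Fin d) => Nᶜ.indicator V z.1 z.2.1 z.2.2) =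
        (Prod.fst ⁻¹' Nᶜ).indicator fun z => V z.1 z.2.1 z.2.2 := by
      ext1 z
      by_cases hz : z.1 ∈ N <;> simp [hz]
    rw [hind]
    exact h.measurable_velocity.indicator (measurable_fst hN.compl)
  · by_cases hs : s ∈ N
    · simp [IsTrajectory, hs]
    · have hs' : s ∈ Nᶜ := hs
      simp only [indicator_of_mem hs', (hwp s hs).runFlow_one]
      exact (hwp s hs).isTrajectory_runFlow
  · have hs' : s ∈ Nᶜ := hs
    simp only [indicator_of_mem hs', (hwp s hs).runFlow_one, and_self]

theorem exists_isReversal (h : IsRegularRandomFlow P V X) : ∃ y w, IsReversal P V X y w := by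
  obtain ⟨V', γ, hV', hγ, htraj, hae⟩ := h.exists_measurable_trajectory
  have hy : Measurable fun p : S × ℝ => reversedPath (γ p.1) p.2 :=
    measurable_reversedPath hγ fun s => (htraj s).continuousOn
  exact ⟨fun s => reversedPath (γ s), fun s r => reversedField (V' s) r (reversedPath (γ s) r),
    { measurable_position := hy
      measurable_velocity := (measurable_reversedField hV').comp
        (measurable_fst.prodMk (measurable_snd.prodMk hy))
      integrable_velocity := fun s => (htraj s).integrable_reversedField
      integral_velocity := fun s => (htraj s).reversedPath_sub
      velocity_eq_zero := fun s r hr => reversedField_of_notMem hr _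
      start_ae_eq := hae.mono fun s hs => by
        rw [reversedPath_of_mem ⟨le_rfl, zero_le_one⟩, sub_zero, hs.2.2]
      ae_eq := hae.mono fun s hs t ht => by
        rw [reversedPath_of_mem (one_sub_mem_Icc ht), reversedField_of_mem (one_sub_mem_Icc ht),
          sub_sub_cancel, hs.1, hs.2.1]
        exact ⟨rfl, rfl⟩ }⟩

end IsRegularRandomFlow

namespace IsReversal

lemma jointLaw_eq_map (h : IsReversal P V X y w) {t : ℝ} (ht : t ∈ Icc (0 : ℝ) 1) :
    jointLaw P V X t = P.map fun s => (y s 0, y s (1 - t), w s (1 - t)) := by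
  refine Measure.map_congr ?_
  filter_upwards [h.start_ae_eq, h.ae_eq] with s hstart hs
  rw [hstart, (hs t ht).1, (hs t ht).2]

lemma measurable_start_position_velocity (h : IsReversal P V X y w) (r : ℝ) :
    Measurable fun s => (y s 0, y s r, w s r) :=
  (h.measurable_position.comp measurable_prodMk_right).prodMk
    ((h.measurable_position.comp measurable_prodMk_right).prodMk
      (h.measurable_velocity.comp measurable_prodMk_right))

lemma lintegral_velocity_eq [SFinite P] (h : IsReversal P V X y w) :
    ∫⁻ s, (∫⁻ r, ‖w s r‖ₑ) ∂P = ∫⁻ t in Icc (0 : ℝ) 1, ∫⁻ z, ‖z.2.2‖ₑ ∂(jointLaw P V X t) := by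
  have hjoint : ∀ t ∈ Icc (0 : ℝ) 1, ∫⁻ z, ‖z.2.2‖ₑ ∂(jointLaw P V X t) =
      ∫⁻ s, ‖w s (1 - t)‖ₑ ∂P := fun t ht => by
    rw [h.jointLaw_eq_map ht,
      lintegral_map measurable_snd.snd.enorm (h.measurable_start_position_velocity _)]
  rw [setLIntegral_congr_fun measurableSet_Icc hjoint,
    lintegral_lintegral_swap h.measurable_velocity.enorm.aemeasurable,
    ← lintegral_sub_left_eq_self (fun r => ∫⁻ s, ‖w s r‖ₑ ∂P) 1]
  refine (setLIntegral_eq_of_support_subset fun t ht => ?_).symm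
  by_contra hmem
  have hmem' : 1 - t ∉ Icc (0 : ℝ) 1 := fun h' => hmem (by simpa using one_sub_mem_Icc h')
  simp [h.velocity_eq_zero _ _ hmem'] at ht

lemma hasVelocity [SFinite P] (h : IsReversal P V X y w) (hV : IsRegularRandomFlow P V X) :
    HasVelocity P y w where
  measurable_position := h.measurable_position
  measurable_velocity := h.measurable_velocity
  integrable_velocity := h.integrable_velocity
  integral_velocity := h.integral_velocity
  lintegral_velocity_ne_top := h.lintegral_velocity_eq ▸ hV.integrable_velocity.ne

lemma ae_eq_condExp_jointLaw_iff [IsFiniteMeasure P] (h : IsReversal P V X y w) {t : ℝ}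
    (ht : t ∈ Icc (0 : ℝ) 1) (hw : Integrable (fun s => w s (1 - t)) P)
    {g : EuclideanSpace ℝ (Fin d) → EuclideanSpace ℝ (Fin d)} (hg : Measurable g) :
    ((fun z => g z.2.1) =ᵐ[jointLaw P V X t]
        (jointLaw P V X t)[fun z => z.2.2 |
          MeasurableSpace.comap (fun z => z.2.1) inferInstance]) ↔
      P[fun s => w s (1 - t) | MeasurableSpace.comap (fun s => y s (1 - t)) inferInstance] =ᵐ[P]
        fun s => g (y s (1 - t)) := by
  have hF := h.measurable_start_position_velocity (1 - t)
  have hpos : Measurable fun z : EuclideanSpace ℝ (Fin d) × EuclideanSpace ℝ (Fin d) ×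
      EuclideanSpace ℝ (Fin d) => z.2.1 := measurable_snd.fst
  have hcond := condExp_map_comp_ae_eq hF hpos.comap_le (Y := fun z => z.2.2)
    ((integrable_map_measure (by fun_prop) hF.aemeasurable).2 hw)
  rw [MeasurableSpace.comap_comp] at hcond
  rw [h.jointLaw_eq_map ht]
  refine (ae_map_iff hF.aemeasurable (measurableSet_eq_fun (hg.comp hpos)
    (stronglyMeasurable_condExp.mono hpos.comap_le).measurable)).trans ?_
  exact ⟨fun hgw => hcond.symm.trans (EventuallyEq.symm hgw), fun hgw => hgw.symm.trans hcond.symm⟩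

end IsReversal

end Reversal

section Combining

variable {d : ℕ} {S : Type*} [MeasurableSpace S] {P : Measure S} {V : S → FlowField d}
  {X : S → EuclideanSpace ℝ (Fin d)}

theorem IsRegularRandomFlow.exists_isMarginalFlow [IsFiniteMeasure P]
    (h : IsRegularRandomFlow P V X) : ∃ vs, IsMarginalFlow P V X vs := by
  obtain ⟨y, w, hyw⟩ := h.exists_isReversal
  obtain ⟨b, hb, hmean⟩ := (hyw.hasVelocity h).exists_hasMeanVelocityAt
  refine ⟨fun t => b (1 - t), hb.comp (by fun_prop : Measurable fun z : ℝ ×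
    EuclideanSpace ℝ (Fin d) => (1 - z.1, z.2)), (ae_restrict_iff' measurableSet_Icc).2 ?_⟩
  filter_upwards [(quasiMeasurePreserving_sub_left volume (1 : ℝ)).ae hmean] with t ht htmem
  exact (hyw.ae_eq_condExp_jointLaw_iff htmem ht.integrable
    (hb.comp measurable_prodMk_left)).2 ht.condExp_ae_eq

lemma IsMarginalFlow.ae_hasMeanVelocityAt [IsFiniteMeasure P] {vs : FlowField d}
    {y w : S → ℝ → EuclideanSpace ℝ (Fin d)} (hvs : IsMarginalFlow P V X vs)
    (h : IsRegularRandomFlow P V X) (hyw : IsReversal P V X y w) :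
    ∀ᵐ r, HasMeanVelocityAt P y w (reversedField vs) r := by
  filter_upwards [(hyw.hasVelocity h).ae_integrable_velocity,
    (quasiMeasurePreserving_sub_left volume (1 : ℝ)).ae
      ((ae_restrict_iff' measurableSet_Icc).1 hvs.2)] with r hw hr
  refine ⟨hw, ?_⟩
  by_cases hmem : r ∈ Icc (0 : ℝ) 1
  · have hcond := (hyw.ae_eq_condExp_jointLaw_iff (one_sub_mem_Icc hmem)
      ((sub_sub_cancel 1 r).symm ▸ hw) (hvs.1.comp measurable_prodMk_left)).1
        (hr (one_sub_mem_Icc hmem))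
    simpa only [reversedField_of_mem hmem, sub_sub_cancel, Function.comp_apply] using hcond
  · simp only [hyw.velocity_eq_zero _ r hmem, reversedField_of_notMem hmem]
    exact EventuallyEq.of_eq condExp_zero

theorem IsMarginalFlow.exists_superposition [IsProbabilityMeasure P] {vs : FlowField d}
    (hvs : IsMarginalFlow P V X vs) (h : IsRegularRandomFlow P V X) :
    ∃ (Q : ProbabilityMeasure (ℚ → EuclideanSpace ℝ (Fin d)))
      (γ : (ℚ → EuclideanSpace ℝ (Fin d)) → ℝ → EuclideanSpace ℝ (Fin d)),
      (∀ t, Measurable fun ω => γ ω t) ∧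
      (∀ t ∈ Icc (0 : ℝ) 1,
        Measure.map (fun ω => γ ω t) Q = P.map fun s => runFlow (V s) (X s) t) ∧
      ∀ᵐ ω ∂(Q : Measure (ℚ → EuclideanSpace ℝ (Fin d))), IsTrajectory vs (γ ω 1) (γ ω) := by
  obtain ⟨y, w, hyw⟩ := h.exists_isReversal
  have hfield : Measurable fun p : ℝ × EuclideanSpace ℝ (Fin d) => reversedField vs p.1 p.2 :=
    (measurable_reversedField (V := fun _ : Unit => vs) (hvs.1.comp measurable_snd)).comp
      (measurable_prodMk_left (x := ()))
  obtain ⟨Q, ρ, hρ, hlaw, hsol⟩ := (hyw.hasVelocity h).exists_superposition hfield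
    (hvs.ae_hasMeanVelocityAt h hyw) 1
  refine ⟨Q, fun ω t => ρ ω (1 - t), fun t => hρ (1 - t), fun t ht => ?_, ?_⟩
  · rw [hlaw (1 - t) (sub_nonneg.2 ht.2)]
    exact Measure.map_congr (hyw.ae_eq.mono fun s hs => (hs t ht).1)
  · filter_upwards [hsol] with ω hω
    simpa only [sub_self] using IsTrajectory.of_reversed hω.1 hω.2

/-- The graph of `X₁` lets one disintegrate `Q` along `X₁`; on almost every fibre `X₀` is constant,
equal to the value of `f`, which is therefore the mean of `X₀` on the fibre. -/
lemma aemeasurable_of_comp_ae_eq {Ω β F : Type*} [MeasurableSpace Ω] [StandardBorelSpace Ω]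
    [Nonempty Ω] [MeasurableSpace β] [MeasurableEq β] [NormedAddCommGroup F] [NormedSpace ℝ F]
    [CompleteSpace F] [SecondCountableTopology F] [MeasurableSpace F] [BorelSpace F]
    {Q : Measure Ω} [IsFiniteMeasure Q] {X₁ : Ω → β} {X₀ : Ω → F} {f : β → F}
    (h₁ : Measurable X₁) (h₀ : Measurable X₀) (hf : ∀ᵐ ω ∂Q, f (X₁ ω) = X₀ ω) :
    AEMeasurable f (Q.map X₁) := by
  obtain ⟨G, hGQ, hG, hGf⟩ := hf.exists_measurable_mem
  have hfibre : ∀ᵐ p ∂(Q.map X₁ ⊗ₘ condDistrib id X₁ Q), p.1 = X₁ p.2 ∧ p.2 ∈ G := by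
    rw [compProd_map_condDistrib aemeasurable_id]
    refine (ae_map_iff (h₁.prodMk measurable_id).aemeasurable
      ((measurableSet_eq_fun measurable_fst (h₁.comp measurable_snd)).inter
        (measurable_snd hG))).2 ?_
    filter_upwards [hGQ] with ω hω using ⟨rfl, hω⟩
  refine ⟨fun x => ∫ ω, X₀ ω ∂condDistrib id X₁ Q x,
    (StronglyMeasurable.integral_condDistrib (f := fun p : β × Ω => X₀ p.2)
      (h₀.comp measurable_snd).stronglyMeasurable).measurable, ?_⟩
  filter_upwards [Measure.ae_ae_of_ae_compProd hfibre] with x hx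
  have hconst : X₀ =ᵐ[condDistrib id X₁ Q x] fun _ => f x := by
    filter_upwards [hx] with ω hω
    rw [hω.1, hGf ω hω.2]
  rw [integral_congr_ae hconst, integral_const, probReal_univ, one_smul]

theorem IsMarginalFlow.transports [IsProbabilityMeasure P] {vs : FlowField d}
    (hvs : IsMarginalFlow P V X vs) (h : IsRegularRandomFlow P V X)
    (hwp : ∀ᵐ x₁ ∂(P.map X), WellPosedAt vs x₁) :
    Transports vs (P.map X) (P.map fun s => runFlow (V s) (X s) 0) := by
  obtain ⟨Q, γ, hγ, hlaw, htraj⟩ := hvs.exists_superposition h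
  have hstart : Measure.map (fun ω => γ ω 1) Q = P.map X :=
    (hlaw 1 ⟨zero_le_one, le_rfl⟩).trans
      (Measure.map_congr (h.wellPosed.mono fun s hs => hs.runFlow_one))
  rw [← hstart] at hwp ⊢
  rw [← hlaw 0 ⟨le_rfl, zero_le_one⟩]
  have hend : ∀ᵐ ω ∂(Q : Measure _), runFlow vs (γ ω 1) 0 = γ ω 0 := by
    filter_upwards [htraj, ae_of_ae_map (hγ 1).aemeasurable hwp] with ω hω hwpω
    exact hwpω.eqOn_runFlow hω ⟨le_rfl, zero_le_one⟩
  have hrun : AEMeasurable (fun x₁ => runFlow vs x₁ 0) (Measure.map (fun ω => γ ω 1) Q) :=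
    aemeasurable_of_comp_ae_eq (f := fun x₁ => runFlow vs x₁ 0) (hγ 1) (hγ 0) hend
  refine ⟨hwp, hrun, ?_⟩
  rw [finalLaw, AEMeasurable.map_map_of_aemeasurable hrun (hγ 1).aemeasurable]
  exact Measure.map_congr hend

lemma map_compProd_eq_bind {Ω α β : Type*} [MeasurableSpace Ω] [MeasurableSpace α]
    [MeasurableSpace β] {Γ : Measure Ω} [SFinite Γ] {q : Kernel Ω α} [IsSFiniteKernel q]
    {f : Ω × α → β} (hf : AEMeasurable f (Γ ⊗ₘ q)) :
    (Γ ⊗ₘ q).map f = Γ.bind fun ω => (q ω).map fun x => f (ω, x) := by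
  obtain ⟨g, hg, hfg⟩ := hf
  have hkernel : (fun ω => (q ω).map fun x => g (ω, x)) = (Kernel.id ×ₖ q).map g := by
    funext ω
    rw [Kernel.map_apply _ hg, Kernel.prod_apply, Kernel.id_apply, Measure.dirac_prod,
      Measure.map_map hg measurable_prodMk_left, Function.comp_def]
  calc (Γ ⊗ₘ q).map f = (Γ ⊗ₘ q).map g := Measure.map_congr hfg
    _ = Γ.bind fun ω => (q ω).map fun x => g (ω, x) := by
      rw [hkernel, Measure.compProd_eq_comp_prod, Measure.map_comp _ _ hg]
    _ = Γ.bind fun ω => (q ω).map fun x => f (ω, x) := by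
      refine congrArg Measure.join (Measure.map_congr ?_)
      filter_upwards [Measure.ae_ae_of_ae_compProd hfg] with ω hω
      exact (Measure.map_congr hω).symm

end Combining

/-- Flow Combining Lemma. The first part is about an arbitrary distribution of pairs
`(v, q_v)` of flows and initial distributions, realised as `ω ↦ (v ω, q ω)` with `ω ∼ Γ`;
the second one is about pointwise flows `u x₁ x₀` and a coupling `C` of `q` and `p`. -/
theorem mainTheorem4 (d : ℕ) :
    (∀ (Ω : Type*) [MeasurableSpace Ω] (Γ : Measure Ω) [IsProbabilityMeasure Γ]
        (v : Ω → FlowField d) (q : Kernel Ω (EuclideanSpace ℝ (Fin d))) [IsMarkovKernel q],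
      IsRegularRandomFlow (Γ ⊗ₘ q) (fun z => v z.1) (fun z => z.2) →
      (∃ vs : FlowField d, IsMarginalFlow (Γ ⊗ₘ q) (fun z => v z.1) (fun z => z.2) vs) ∧
      ∀ vs : FlowField d, IsMarginalFlow (Γ ⊗ₘ q) (fun z => v z.1) (fun z => z.2) vs →
        (∀ᵐ x₁ ∂(Γ.bind q), WellPosedAt vs x₁) →
        Transports vs (Γ.bind q) (Γ.bind (fun ω => finalLaw (v ω) (q ω)))) ∧
    (∀ (q p : Measure (EuclideanSpace ℝ (Fin d))) [IsProbabilityMeasure q] [IsProbabilityMeasure p]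
        (C : Measure (EuclideanSpace ℝ (Fin d) × EuclideanSpace ℝ (Fin d)))
        (u : EuclideanSpace ℝ (Fin d) → EuclideanSpace ℝ (Fin d) → FlowField d),
      C.fst = q → C.snd = p →
      (∀ᵐ z ∂C, IsPointwiseFlow (u z.1 z.2) z.1 z.2) →
      IsRegularRandomFlow C (fun z => u z.1 z.2) (fun z => z.1) →
      (∃ vs : FlowField d, IsMarginalFlow C (fun z => u z.1 z.2) (fun z => z.1) vs) ∧
      ∀ vs : FlowField d, IsMarginalFlow C (fun z => u z.1 z.2) (fun z => z.1) vs →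
        (∀ᵐ x₁ ∂q, WellPosedAt vs x₁) → Transports vs q p) := by
  constructor
  · intro Ω _ Γ _ v q _ h
    refine ⟨h.exists_isMarginalFlow, fun vs hvs hwp => ?_⟩
    have hinit : (Γ ⊗ₘ q).map (fun z => z.2) = Γ.bind q := Measure.snd_compProd Γ q
    have hfinal : (Γ ⊗ₘ q).map (fun z => runFlow (v z.1) z.2 0) =
        Γ.bind (fun ω => finalLaw (v ω) (q ω)) :=
      map_compProd_eq_bind (h.aemeasurable_position 0 ⟨le_rfl, zero_le_one⟩)
    rw [← hinit] at hwp ⊢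
    exact hfinal ▸ hvs.transports h hwp
  · rintro q p _ _ C u rfl rfl hu h
    have : IsProbabilityMeasure C := ⟨by rw [← Measure.fst_univ, measure_univ]⟩
    have hfinal : C.map (fun z => runFlow (u z.1 z.2) z.1 0) = C.snd :=
      Measure.map_congr (hu.mono fun z hz => hz.2)
    exact ⟨h.exists_isMarginalFlow, fun vs hvs hwp => hfinal ▸ hvs.transports h hwp⟩
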